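/- Let $\mathbb{F}_q$ be the finite field with $q$ elements, let $n \ge 1$ be an integer, and let $g \in \mathbb{F}_q[x]$ have degree $\delta = \deg g \ge 1$. Let $\widetilde{R}(n,g,q)$ be the number of (not necessarily monic) polynomials $f \in \mathbb{F}_q[x]$ of degree $n$ which can be written in the form $f = h + g^k$, where $h \in \mathbb{F}_q[x]$ is an irreducible (not necessarily monic) polynomial of degree $n$ and $k$ is a nonnegative integer, and let $$\widetilde{r}(n,g,q) = \frac{\widetilde{R}(n,g,q)}{(q-1)q^n}$$ be the proportion of such polynomials among all polynomials of degree $n$ over $\mathbb{F}_q$. Then $$\frac{1+\delta/n}{\delta} \ \ge\ \widetilde{r}(n,g,q) \ >\ \frac{\left(1-2q^{-n/2}\right)^2 \left(1+\delta/n\right)^{-1}}{\delta + 8\,\frac{q}{q-1}\left(1+e^{\gamma}\min\left\{5\sqrt{\delta/q},\ \frac{\log (6\delta)}{\log q}\right\}\right)},$$ where $\gamma$ denotes Euler's constant. -/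

import Mathlib

noncomputable section

/-- The set of (not necessarily monic) polynomials `f` of degree `n` over `F` that can be written
as `f = h + g ^ k` with `h` an irreducible (not necessarily monic) polynomial of degree `n` and
`k` a nonnegative integer. -/
def romanoffSet {F : Type*} [Field F] (n : ℕ) (g : Polynomial F) : Set (Polynomial F) :=
  {f | f.degree = n ∧ ∃ (h : Polynomial F) (k : ℕ),
    Irreducible h ∧ h.degree = n ∧ f = h + g ^ k}

/-- `R̃(n, g, q)`: the number of elements of `romanoffSet n g` (a finite set when `F` is finite). -/
def romanoffCount {F : Type*} [Field F] (n : ℕ) (g : Polynomial F) : ℕ :=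
  (romanoffSet n g).ncard

/-- `r̃(n, g, q) = R̃(n, g, q) / ((q - 1) q ^ n)` with `q = #F`: the proportion of the polynomials of
degree `n` over `F` that belong to `romanoffSet n g`. -/
def romanoffProportion {F : Type*} [Field F] [Fintype F] (n : ℕ) (g : Polynomial F) : ℝ :=
  (romanoffCount n g : ℝ) / (((Fintype.card F : ℝ) - 1) * (Fintype.card F : ℝ) ^ n)

end

/-! The lower bound is Romanoff's argument. Let `N` be the number of irreducible `h` of degree `n`,
close to `(q - 1) q ^ n / n` by Gauss's formula. Consider the sums `h + g ^ k` with `k ≤ X`, where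
`X` is the largest integer with `X * δ < n`, so that adding `g ^ k` leaves the degree unchanged. By
Cauchy–Schwarz the number of distinct sums is at least `(N (X + 1)) ^ 2` divided by the number of
coincidences `h + g ^ k = h' + g ^ l` (`sq_card_irreducibles_le`).

The coincidences with `k = l` number `N (X + 1)` and produce the term `δ` of the denominator. If `k
≠ l`, then `h` and `h + D` are both irreducible, where `D = g ^ k - g ^ l`. By `card_twins_le` this
happens at most `8 (q - 1) q ^ n / n ^ 2` times `|D| / φ(D)`. The tool is a large sieve without
error term, because polynomials of degree less than `n` are exactly equidistributed modulo any
product of degree at most `n` (`large_sieve`). The sieve density is bounded below by comparison with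
the square of the zeta series (`le_totientRatio_mul_sieve_sum`).

It remains to average `|D| / φ(D)`. Only `j = |k - l|` matters, through the primes dividing `g (g ^
j - 1)`, that is, those modulo which the order of `g` divides `j`. Expanding the product and summing
by parts (`sum_totientRatio_le`) bounds the average by a mean, with weights `1 / (x (x + 1))`, of
`|B| / φ(B)` for a polynomial `B` of degree `δ (2 + x (x - 1) / 2)` that is divisible by every prime
of order at most `x`. An explicit Mertens bound (`totientRatio_le`), resting on `exp_harmonic_le`,
gives `log (6 δ) / log q`. When `q ≥ 25 δ`, a sharper estimate for degrees at most `q` also gives `5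
√(δ / q)` (`abelMean_totientRatio_le`).

The upper bound merely counts pairs: `k ≤ n / δ` and `n N ≤ (q - 1) q ^ n`. -/

namespace PolynomialSieve

open Polynomial Finset

/-! ### Counting monic irreducible polynomials -/

section Counting

variable {F : Type*} [Field F] [Fintype F]

/-- The polynomials of degree less than `n`, as a finset. -/
noncomputable def ltDegree (F : Type*) [Field F] [Fintype F] (n : ℕ) : Finset F[X] :=
  (univ : Finset (Fin n → F)).map
    ((degreeLTEquiv F n).symm.toEquiv.toEmbedding.trans (Function.Embedding.subtype _))

lemma mem_ltDegree {n : ℕ} {f : F[X]} : f ∈ ltDegree F n ↔ f.degree < n := by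
  simp only [ltDegree, mem_map, mem_univ, true_and]
  constructor
  · rintro ⟨v, rfl⟩
    exact mem_degreeLT.1 ((degreeLTEquiv F n).symm v).2
  · intro h
    exact ⟨degreeLTEquiv F n ⟨f, mem_degreeLT.2 h⟩, by simp⟩

lemma card_ltDegree (n : ℕ) : (ltDegree F n).card = Fintype.card F ^ n := by
  simp [ltDegree]

open scoped Classical in
/-- Monic polynomials of degree `n`. -/
noncomputable def monicDegree (F : Type*) [Field F] [Fintype F] (n : ℕ) : Finset F[X] :=
  (ltDegree F n).image fun r => X ^ n + r

lemma mem_monicDegree {n : ℕ} {f : F[X]} : f ∈ monicDegree F n ↔ f.Monic ∧ f.natDegree = n := by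
  simp only [monicDegree, mem_image, mem_ltDegree]
  constructor
  · rintro ⟨r, hr, rfl⟩
    exact ⟨monic_X_pow_add hr, natDegree_eq_of_degree_eq_some (by
      rw [degree_add_eq_left_of_degree_lt] <;> simp [hr])⟩
  · rintro ⟨hf, rfl⟩
    refine ⟨f - X ^ f.natDegree, ?_, by ring⟩
    have h0 : f ≠ 0 := hf.ne_zero
    rw [← degree_eq_natDegree h0]
    exact degree_sub_lt_left (by simp [degree_eq_natDegree h0]) h0 (by simp [hf.leadingCoeff])

lemma card_monicDegree (n : ℕ) : (monicDegree F n).card = Fintype.card F ^ n := by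
  classical
  rw [monicDegree, card_image_of_injective _ (add_right_injective _), card_ltDegree]

open scoped Classical in
/-- Monic irreducible polynomials of degree `n`. -/
noncomputable def primesOfDegree (F : Type*) [Field F] [Fintype F] (n : ℕ) : Finset F[X] :=
  (monicDegree F n).filter Irreducible

lemma mem_primesOfDegree {n : ℕ} {f : F[X]} :
    f ∈ primesOfDegree F n ↔ f.Monic ∧ f.natDegree = n ∧ Irreducible f := by
  simp [primesOfDegree, mem_monicDegree, and_assoc]

lemma primesOfDegree_zero : primesOfDegree F 0 = ∅ := by
  ext f
  simp only [mem_primesOfDegree, notMem_empty, iff_false, not_and]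
  intro _ h1 h2
  exact absurd h1 h2.natDegree_pos.ne'

open scoped Classical in
/-- Monic irreducible polynomials of degree at most `m`. -/
noncomputable def primesLE (F : Type*) [Field F] [Fintype F] (m : ℕ) : Finset F[X] :=
  (range (m + 1)).biUnion (primesOfDegree F)

lemma mem_primesLE {m : ℕ} {f : F[X]} :
    f ∈ primesLE F m ↔ f.Monic ∧ Irreducible f ∧ f.natDegree ≤ m := by
  simp only [primesLE, mem_biUnion, mem_range, mem_primesOfDegree]
  constructor
  · rintro ⟨a, h, h1, rfl, h2⟩
    exact ⟨h1, h2, by omega⟩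
  · rintro ⟨h1, h2, h3⟩
    exact ⟨_, by omega, h1, rfl, h2⟩

lemma pairwiseDisjoint_primesOfDegree (s : Set ℕ) : s.PairwiseDisjoint (primesOfDegree F) := by
  intro a _ b _ hab
  rw [Function.onFun, Finset.disjoint_left]
  intro f hf hf'
  exact hab ((mem_primesOfDegree.1 hf).2.1.symm.trans (mem_primesOfDegree.1 hf').2.1)

lemma sum_primesLE {M : Type*} [AddCommMonoid M] (m : ℕ) (φ : F[X] → M) :
    ∑ P ∈ primesLE F m, φ P = ∑ d ∈ Icc 1 m, ∑ P ∈ primesOfDegree F d, φ P := by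
  classical
  rw [primesLE, sum_biUnion (pairwiseDisjoint_primesOfDegree _), range_eq_Ico,
    sum_eq_sum_Ico_succ_bot (by omega), primesOfDegree_zero]
  simp
  rfl

lemma pairwise_isCoprime_primes {K : Type*} [Field K] {s : Set K[X]} (hs : ∀ P ∈ s, P.Monic ∧ Irreducible P) :
    s.Pairwise IsCoprime := by
  intro P hP Q hQ hPQ
  rw [(hs P hP).2.coprime_iff_not_dvd]
  intro h
  exact hPQ (eq_of_monic_of_associated (hs P hP).1 (hs Q hQ).1
    ((hs P hP).2.associated_of_dvd (hs Q hQ).2 h))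

lemma separable_X_pow_card_pow_sub_X {n : ℕ} (hn : n ≠ 0) :
    (X ^ (Fintype.card F ^ n) - X : F[X]).Separable := by
  obtain ⟨p, hp⟩ := CharP.exists F
  have h1 : p ∣ Fintype.card F := by
    rw [← CharP.cast_eq_zero_iff F p]; exact FiniteField.cast_card_eq_zero F
  exact galois_poly_separable p _ (h1.trans (dvd_pow_self _ hn))

/-- Gauss: `∑_{d ∣ n} d π(d) = q ^ n`. -/
theorem sum_divisors_card_primes {n : ℕ} (hn : n ≠ 0) :
    ∑ d ∈ n.divisors, d * (primesOfDegree F d).card = Fintype.card F ^ n := by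
  classical
  set A : F[X] := X ^ (Fintype.card F ^ n) - X with hA
  have hq : 1 < Fintype.card F := Fintype.one_lt_card
  have hA0 : A ≠ 0 := FiniteField.X_pow_card_pow_sub_X_ne_zero F hn hq
  have hAdeg : A.natDegree = Fintype.card F ^ n :=
    FiniteField.X_pow_card_pow_sub_X_natDegree_eq F hn hq
  have hAmon : A.Monic := by
    refine monic_X_pow_sub ?_
    rw [degree_X]
    exact_mod_cast one_lt_pow₀ hq hn
  have hsq : Squarefree A := (separable_X_pow_card_pow_sub_X hn).squarefree
  have key : A = ∏ d ∈ n.divisors, ∏ P ∈ primesOfDegree F d, P := by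
    rw [← prod_biUnion (pairwiseDisjoint_primesOfDegree _)]
    have hset : n.divisors.biUnion (primesOfDegree F)
        = (UniqueFactorizationMonoid.normalizedFactors A).toFinset := by
      ext P
      simp only [mem_biUnion, Multiset.mem_toFinset, mem_primesOfDegree,
        UniqueFactorizationMonoid.mem_normalizedFactors_iff' hA0]
      constructor
      · rintro ⟨d, hd, h1, rfl, h2⟩
        refine ⟨h2, h1.normalize_eq_self, ?_⟩
        rw [hA, ← Nat.card_eq_fintype_card, ← h2.natDegree_dvd_iff_dvd_X_pow_card_pow_sub_X]
        exact Nat.dvd_of_mem_divisors hd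
      · rintro ⟨h1, h2, h3⟩
        refine ⟨P.natDegree, ?_, ?_, rfl, h1⟩
        · rw [hA, ← Nat.card_eq_fintype_card,
            ← h1.natDegree_dvd_iff_dvd_X_pow_card_pow_sub_X] at h3
          exact Nat.mem_divisors.2 ⟨h3, hn⟩
        · rw [← h2]; exact monic_normalize h1.ne_zero
    rw [hset]
    have hnd := (UniqueFactorizationMonoid.squarefree_iff_nodup_normalizedFactors hA0).1 hsq
    rw [Finset.prod_eq_multiset_prod]
    simp only [Multiset.map_id', Multiset.toFinset_val, hnd.dedup]
    rw [UniqueFactorizationMonoid.prod_normalizedFactors_eq hA0, hAmon.normalize_eq_self]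
  rw [← hAdeg, key, natDegree_prod_of_monic _ _ (fun d _ =>
    monic_prod_of_monic _ _ fun P hP => (mem_primesOfDegree.1 hP).1)]
  refine sum_congr rfl fun d _ => ?_
  rw [natDegree_prod_of_monic _ _ fun P hP => (mem_primesOfDegree.1 hP).1,
    sum_congr rfl fun P hP => (mem_primesOfDegree.1 hP).2.1]
  simp [mul_comm]

lemma mul_card_primes_le (n : ℕ) : n * (primesOfDegree F n).card ≤ Fintype.card F ^ n := by
  rcases eq_or_ne n 0 with rfl | hn
  · simp
  rw [← sum_divisors_card_primes hn]
  exact single_le_sum (f := fun d => d * (primesOfDegree F d).card) (fun _ _ => Nat.zero_le _)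
    (Nat.mem_divisors_self n hn)

lemma card_primes_one : (primesOfDegree F 1).card = Fintype.card F := by
  simpa using sum_divisors_card_primes (F := F) one_ne_zero

/-- The linear primes alone contribute `q` to Gauss's identity. Later only a saving of 1 matters: it
gives `n π(n) ≤ q ^ n - 1`, which pairs exactly with `mul_primeWeight_le`. -/
lemma mul_card_primes_add_le {n : ℕ} (hn : 2 ≤ n) :
    n * (primesOfDegree F n).card + Fintype.card F ≤ Fintype.card F ^ n := by
  rw [← sum_divisors_card_primes (by omega : n ≠ 0)]
  have h : ({n, 1} : Finset ℕ) ⊆ n.divisors := by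
    intro x; simp only [mem_insert, mem_singleton, Nat.mem_divisors]
    rintro (rfl | rfl) <;> simp <;> omega
  refine le_trans (le_of_eq ?_) (sum_le_sum_of_subset h)
  rw [sum_pair (by omega), card_primes_one, one_mul]

lemma card_pow_le_sum_primes {L : ℕ} (hL : L ≠ 0) :
    Fintype.card F ^ L ≤ ∑ d ∈ Icc 1 L, d * (primesOfDegree F d).card := by
  rw [← sum_divisors_card_primes hL]
  refine sum_le_sum_of_subset fun d hd => ?_
  rw [mem_Icc]
  exact ⟨Nat.pos_of_mem_divisors hd, Nat.divisor_le hd⟩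

/-- Proper divisors of `n` are at most `n / 2`, so the remaining terms of Gauss's identity are
dominated by a geometric series of ratio at least 2. -/
lemma card_pow_lt_mul_card_primes_add (n : ℕ) (hn : n ≠ 0) :
    Fintype.card F ^ n < n * (primesOfDegree F n).card + 2 * Fintype.card F ^ (n / 2) := by
  have hq : 2 ≤ Fintype.card F := Fintype.one_lt_card
  have hgeom : ∀ m, ∑ d ∈ range (m + 1), Fintype.card F ^ d < 2 * Fintype.card F ^ m := by
    intro m
    induction m with
    | zero => simp
    | succ m ih =>
      rw [sum_range_succ]
      have : 2 * Fintype.card F ^ m ≤ Fintype.card F ^ (m + 1) := by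
        rw [pow_succ']; gcongr
      omega
  rw [← sum_divisors_card_primes hn, ← Nat.insert_self_properDivisors hn,
    sum_insert Nat.self_notMem_properDivisors]
  refine Nat.add_lt_add_left (lt_of_le_of_lt ?_ (hgeom (n / 2))) _
  refine (sum_le_sum fun d _ => mul_card_primes_le d).trans (sum_le_sum_of_subset fun d hd => ?_)
  obtain ⟨⟨c, hc⟩, hlt⟩ := Nat.mem_properDivisors.1 hd
  have hc2 : 2 ≤ c := by
    by_contra! h
    interval_cases c <;> omega
  rw [mem_range, Nat.lt_succ_iff, Nat.le_div_iff_mul_le two_pos, hc]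
  gcongr

lemma lt_mul_card_primes {n : ℕ} (hn : n ≠ 0) :
    (Fintype.card F : ℝ) ^ n * (1 - 2 * (Fintype.card F : ℝ) ^ (-(n : ℝ) / 2))
      < n * (primesOfDegree F n).card := by
  have hq : (2 : ℝ) ≤ Fintype.card F := by exact_mod_cast (Fintype.one_lt_card : 1 < Fintype.card F)
  have h := card_pow_lt_mul_card_primes_add (F := F) n hn
  have h' : (Fintype.card F : ℝ) ^ n
      < n * (primesOfDegree F n).card + 2 * (Fintype.card F : ℝ) ^ (n / 2) := by exact_mod_cast h
  have h2 : (Fintype.card F : ℝ) ^ (n / 2)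
      ≤ (Fintype.card F : ℝ) ^ n * (Fintype.card F : ℝ) ^ (-(n : ℝ) / 2) := by
    rw [← Real.rpow_natCast, ← Real.rpow_natCast, ← Real.rpow_add (by linarith)]
    refine Real.rpow_le_rpow_of_exponent_le (by linarith) ?_
    have : ((n / 2 : ℕ) : ℝ) ≤ (n : ℝ) / 2 := Nat.cast_div_le
    linarith
  linarith

end Counting

/-! ### Exact equidistribution and the large sieve -/

section LargeSieve

variable {F : Type*} [Field F] [Fintype F]

/-- Division with remainder is a bijection onto pairs (quotient, remainder), so every residue is hit
equally often. -/
lemma sum_ltDegree_modByMonic {B : F[X]} (hB : B.Monic) {n : ℕ} (hn : B.natDegree ≤ n)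
    (f : F[X] → ℝ) :
    ∑ r ∈ ltDegree F n, f (r %ₘ B)
      = (Fintype.card F : ℝ) ^ (n - B.natDegree) * ∑ a ∈ ltDegree F B.natDegree, f a := by
  have hB0 : B ≠ 0 := hB.ne_zero
  have hdB : B.degree = (B.natDegree : WithBot ℕ) := degree_eq_natDegree hB0
  have h1 : ∑ r ∈ ltDegree F n, f (r %ₘ B)
      = ∑ p ∈ ltDegree F (n - B.natDegree) ×ˢ ltDegree F B.natDegree, f p.2 := by
    refine sum_nbij' (fun r => (r /ₘ B, r %ₘ B)) (fun p => p.2 + B * p.1) ?_ ?_ ?_ ?_ ?_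
    · intro r hr
      rw [mem_ltDegree] at hr
      rw [mem_product, mem_ltDegree, mem_ltDegree]
      refine ⟨?_, hdB ▸ degree_modByMonic_lt r hB⟩
      by_cases hlt : r.degree < B.degree
      · rw [(divByMonic_eq_zero_iff hB).2 hlt]
        simp
      · push Not at hlt
        have h2 := degree_add_divByMonic hB hlt
        have hr0 : r ≠ 0 := by
          rintro rfl
          rw [degree_zero, hdB] at hlt
          simp at hlt
        have hd0 : r /ₘ B ≠ 0 := by
          rw [Ne, divByMonic_eq_zero_iff hB]; exact not_lt.2 hlt
        rw [degree_eq_natDegree hr0] at h2 hr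
        rw [degree_eq_natDegree hd0] at h2 ⊢
        rw [hdB] at h2
        norm_cast at h2 hr ⊢
        omega
    · intro p hp
      rw [mem_product, mem_ltDegree, mem_ltDegree] at hp
      rw [mem_ltDegree]
      refine (degree_add_le _ _).trans_lt (max_lt (hp.2.trans_le (by exact_mod_cast hn)) ?_)
      rcases eq_or_ne p.1 0 with h0 | h0
      · simp [h0]
      · have h3 := hp.1
        rw [degree_mul, hdB]
        rw [degree_eq_natDegree h0] at h3 ⊢
        norm_cast at h3 ⊢
        omega
    · intro r _
      exact modByMonic_add_div r B
    · intro p hp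
      rw [mem_product, mem_ltDegree, mem_ltDegree] at hp
      have := div_modByMonic_unique (f := p.2 + B * p.1) p.1 p.2 hB ⟨rfl, by rw [hdB]; exact hp.2⟩
      exact Prod.ext this.1 this.2
    · intro r _; rfl
  rw [h1, sum_product]
  simp only [sum_const, card_ltDegree, nsmul_eq_mul]
  push_cast; rfl

/-- Equidistribution of the polynomials of degree less than `n` in residue classes modulo distinct
primes of total degree at most `n`. -/
theorem sum_ltDegree_prod (A : Finset F[X]) (hA : ∀ P ∈ A, P.Monic ∧ Irreducible P) {n : ℕ}
    (hn : ∑ P ∈ A, P.natDegree ≤ n) (v : F[X] → F[X] → ℝ)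
    (hv : ∀ P ∈ A, ∀ r s, P ∣ r - s → v P r = v P s) :
    ∑ r ∈ ltDegree F n, ∏ P ∈ A, v P r
      = (Fintype.card F : ℝ) ^ n * ∏ P ∈ A,
          ((∑ a ∈ ltDegree F P.natDegree, v P a) / (Fintype.card F : ℝ) ^ P.natDegree) := by
  classical
  set B := ∏ P ∈ A, P with hBdef
  have hBm : B.Monic := monic_prod_of_monic _ _ fun P hP => (hA P hP).1
  have hBd : B.natDegree = ∑ P ∈ A, P.natDegree :=
    natDegree_prod_of_monic _ _ fun P hP => (hA P hP).1
  have hq : (Fintype.card F : ℝ) ≠ 0 := by exact_mod_cast Fintype.card_ne_zero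
  have h1 : ∀ r, ∏ P ∈ A, v P r = ∏ P ∈ A, v P (r %ₘ B) := by
    intro r
    refine prod_congr rfl fun P hP => hv P hP _ _ ?_
    have : r - r %ₘ B = B * (r /ₘ B) := by
      rw [sub_eq_iff_eq_add, add_comm]; exact (modByMonic_add_div r B).symm
    rw [this]
    exact (dvd_prod_of_mem _ hP).mul_right _
  rw [sum_congr rfl fun r _ => h1 r, sum_ltDegree_modByMonic hBm (hBd ▸ hn)
    (fun r => ∏ P ∈ A, v P r), prod_div_distrib, prod_pow_eq_pow_sum, ← hBd,
    prod_sum A (fun P => ltDegree F P.natDegree) (fun P a => v P a)]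
  have h2 : ∑ a ∈ ltDegree F B.natDegree, ∏ P ∈ A, v P a
      = ∑ p ∈ A.pi fun P => ltDegree F P.natDegree, ∏ x ∈ A.attach, v x.1 (p x.1 x.2) := by
    let φ : F[X] → (∀ P ∈ A, F[X]) := fun a P _ => a %ₘ P
    have hinj : Set.InjOn φ (ltDegree F B.natDegree) := by
      intro a ha b hb hab
      rw [mem_coe, mem_ltDegree] at ha hb
      have hdvd : B ∣ a - b := by
        refine Finset.prod_dvd_of_coprime ?_ fun P hP => ?_
        · exact pairwise_isCoprime_primes hA
        · have h := congrFun (congrFun hab P) hP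
          simp only [φ] at h
          rw [← (modByMonic_eq_zero_iff_dvd (hA P hP).1), sub_modByMonic, h, sub_self]
      by_contra hne
      have := degree_le_of_dvd hdvd (sub_ne_zero.2 hne)
      refine absurd ((degree_sub_le a b).trans_lt (max_lt ha hb)) (not_lt.2 ?_)
      rwa [degree_eq_natDegree hBm.ne_zero] at this
    -- Injectivity and equality of cardinalities make `φ` the Chinese remainder bijection.
    have himg : (ltDegree F B.natDegree).image φ = A.pi fun P => ltDegree F P.natDegree := by
      refine eq_of_subset_of_card_le ?_ ?_
      · intro p hp
        obtain ⟨a, -, rfl⟩ := mem_image.1 hp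
        rw [mem_pi]
        intro P hP
        rw [mem_ltDegree, ← degree_eq_natDegree (hA P hP).1.ne_zero]
        exact degree_modByMonic_lt a (hA P hP).1
      · rw [card_image_of_injOn hinj, card_pi, card_ltDegree, hBd]
        simp [card_ltDegree, prod_pow_eq_pow_sum]
    rw [← himg, sum_image hinj]
    refine sum_congr rfl fun a _ => ?_
    rw [← prod_attach]
    refine prod_congr rfl fun P _ => hv _ P.2 _ _ ?_
    have : a - a %ₘ P.1 = P.1 * (a /ₘ P.1) := by
      rw [sub_eq_iff_eq_add, add_comm]; exact (modByMonic_add_div a P.1).symm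
    simp only [φ, this]
    exact dvd_mul_right _ _
  rw [h2, ← mul_div_assoc, eq_div_iff (pow_ne_zero _ hq), mul_right_comm, ← pow_add,
    Nat.sub_add_cancel (hBd ▸ hn)]

/-- The (dual) large sieve: a set of polynomials avoiding `ω P` residue classes modulo `P`. -/
theorem large_sieve {n m : ℕ} (hmn : 2 * m ≤ n) (𝒬 : Finset F[X])
    (h𝒬 : ∀ P ∈ 𝒬, P.Monic ∧ Irreducible P) (bad : F[X] → F[X] → Prop)
    [∀ P r, Decidable (bad P r)]
    (hbad : ∀ P ∈ 𝒬, ∀ r s, P ∣ r - s → (bad P r ↔ bad P s)) (ω : F[X] → ℕ)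
    (hω : ∀ P ∈ 𝒬, ((ltDegree F P.natDegree).filter (bad P)).card = ω P)
    (hωlt : ∀ P ∈ 𝒬, ω P < Fintype.card F ^ P.natDegree)
    (S : Finset F[X]) (hS : S ⊆ ltDegree F n) (hSbad : ∀ r ∈ S, ∀ P ∈ 𝒬, ¬ bad P r) :
    (S.card : ℝ) * ∑ A ∈ 𝒬.powerset with ∑ P ∈ A, P.natDegree ≤ m,
        ∏ P ∈ A, ((ω P : ℝ) / ((Fintype.card F : ℝ) ^ P.natDegree - ω P))
      ≤ (Fintype.card F : ℝ) ^ n := by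
  classical
  set q : ℝ := (Fintype.card F : ℝ) with hqdef
  set h : F[X] → ℝ := fun P => (ω P : ℝ) / (q ^ P.natDegree - ω P) with hh
  set I := {A ∈ 𝒬.powerset | ∑ P ∈ A, P.natDegree ≤ m} with hI
  set L := ∑ A ∈ I, ∏ P ∈ A, h P with hL
  -- The value `h P` is chosen so that `u P` has mean zero over the residues modulo `P`. On `S` it
  -- is constantly `h P`.
  set u : F[X] → F[X] → ℝ := fun P r => if bad P r then -1 else h P with hu
  have hgap : ∀ P ∈ 𝒬, 0 < q ^ P.natDegree - ω P := by
    intro P hP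
    have := hωlt P hP
    rw [sub_pos, hqdef]
    exact_mod_cast this
  have hh0 : ∀ P ∈ 𝒬, 0 ≤ h P := fun P hP => div_nonneg (Nat.cast_nonneg _) (hgap P hP).le
  have hIsub : ∀ A ∈ I, A ⊆ 𝒬 := fun A hA => mem_powerset.1 (mem_filter.1 hA).1
  have hIdeg : ∀ A ∈ I, ∑ P ∈ A, P.natDegree ≤ m := fun A hA => (mem_filter.1 hA).2
  have hsum : ∀ P ∈ 𝒬, ∀ x y : ℝ, ∑ a ∈ ltDegree F P.natDegree, (if bad P a then x else y)
      = ω P * x + (q ^ P.natDegree - ω P) * y := by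
    intro P hP x y
    rw [sum_ite, sum_const, sum_const, hω P hP, nsmul_eq_mul, nsmul_eq_mul]
    congr 2
    have h1 := card_filter_add_card_filter_not (s := ltDegree F P.natDegree) (bad P)
    rw [hω P hP, card_ltDegree] at h1
    rw [hqdef, eq_sub_iff_add_eq']
    exact_mod_cast h1
  have hu1 : ∀ P ∈ 𝒬, ∑ a ∈ ltDegree F P.natDegree, u P a = 0 := by
    intro P hP
    have := (hgap P hP).ne'
    simp only [hu, hsum P hP, hh]
    field_simp
    ring
  have hu2 : ∀ P ∈ 𝒬, ∑ a ∈ ltDegree F P.natDegree, u P a * u P a = q ^ P.natDegree * h P := by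
    intro P hP
    have := (hgap P hP).ne'
    have h1 : ∀ a, u P a * u P a = if bad P a then 1 else h P * h P := by
      intro a; simp only [hu]; split_ifs <;> ring
    simp only [h1, hsum P hP, hh]
    field_simp
    ring
  have huper : ∀ P ∈ 𝒬, ∀ r s, P ∣ r - s → u P r = u P s := by
    intro P hP r s hrs
    simp only [hu, hbad P hP r s hrs]
  -- The total degree of `A ∪ B` is at most `2 * m ≤ n`, so equidistribution is exact, and a prime
  -- in just one of the two sets contributes a factor 0.
  have horth : ∀ A ∈ I, ∀ B ∈ I, ∑ r ∈ ltDegree F n, (∏ P ∈ A, u P r) * ∏ P ∈ B, u P r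
      = if A = B then q ^ n * ∏ P ∈ A, h P else 0 := by
    intro A hA B hB
    set v : F[X] → F[X] → ℝ := fun P r => (if P ∈ A then u P r else 1) * (if P ∈ B then u P r else 1)
      with hvdef
    have hsub : A ∪ B ⊆ 𝒬 := union_subset (hIsub A hA) (hIsub B hB)
    have hprod : ∀ r, (∏ P ∈ A, u P r) * ∏ P ∈ B, u P r = ∏ P ∈ A ∪ B, v P r := by
      intro r
      rw [hvdef, prod_mul_distrib, prod_ite_mem, prod_ite_mem]
      congr 2
      · rw [inter_eq_right.2 subset_union_left]
      · rw [inter_eq_right.2 subset_union_right]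
    have hdeg : ∑ P ∈ A ∪ B, P.natDegree ≤ n := by
      have h1 : ∑ P ∈ A ∪ B, P.natDegree ≤ ∑ P ∈ A, P.natDegree + ∑ P ∈ B, P.natDegree := by
        rw [← sum_union_inter]; exact Nat.le_add_right _ _
      have := hIdeg A hA
      have := hIdeg B hB
      omega
    rw [sum_congr rfl fun r _ => hprod r, sum_ltDegree_prod (A ∪ B) (fun P hP => h𝒬 P (hsub hP)) hdeg]
    · split_ifs with hAB
      · subst hAB
        rw [union_self]
        congr 1
        refine prod_congr rfl fun P hP => ?_
        have hP' := hIsub A hA hP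
        have hq0 : q ^ P.natDegree ≠ 0 := pow_ne_zero _ (by
          rw [hqdef]; exact_mod_cast Fintype.card_ne_zero)
        simp only [hvdef, hP, if_true]
        rw [hu2 P hP', mul_div_cancel_left₀ _ hq0]
      · obtain ⟨P, hP, hPv⟩ : ∃ P ∈ A ∪ B, ∀ r, v P r = u P r := by
          by_contra! hcon
          refine hAB (Finset.ext fun P => ⟨fun hPA => ?_, fun hPB => ?_⟩)
          · by_contra hPB
            obtain ⟨r, hr⟩ := hcon P (mem_union_left _ hPA)
            simp [hvdef, hPA, hPB] at hr
          · by_contra hPA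
            obtain ⟨r, hr⟩ := hcon P (mem_union_right _ hPB)
            simp [hvdef, hPA, hPB] at hr
        rw [prod_eq_zero hP, mul_zero]
        rw [sum_congr rfl fun r _ => hPv r, hu1 P (hsub hP), zero_div]
    · intro P hP r s hrs
      simp only [hvdef, huper P (hsub hP) r s hrs]
  have hU2 : ∑ r ∈ ltDegree F n, (∑ A ∈ I, ∏ P ∈ A, u P r) ^ 2 = q ^ n * L := by
    simp_rw [sq, sum_mul_sum]
    rw [sum_comm]
    simp_rw [sum_comm (s := ltDegree F n)]
    rw [hL, mul_sum]
    refine sum_congr rfl fun A hA => ?_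
    rw [sum_congr rfl fun B hB => horth A hA B hB, sum_ite_eq, if_pos hA]
  have hUS : ∀ r ∈ S, ∑ A ∈ I, ∏ P ∈ A, u P r = L := by
    intro r hr
    refine sum_congr rfl fun A hA => prod_congr rfl fun P hP => ?_
    simp only [hu, hSbad r hr P (hIsub A hA hP), if_false]
  have hL0 : 0 < L := by
    have hmem : ∅ ∈ I := by simp [hI]
    refine lt_of_lt_of_le zero_lt_one ?_
    calc (1 : ℝ) = ∏ P ∈ (∅ : Finset F[X]), h P := by simp
      _ ≤ L := single_le_sum (f := fun A => ∏ P ∈ A, h P)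
        (fun A hA => prod_nonneg fun P hP => hh0 P (hIsub A hA hP)) hmem
  -- The sum of the orthogonal products is `L` at each point of `S`, while its squares over all of
  -- `ltDegree F n` add up to `q ^ n * L`.
  have hfin : (S.card : ℝ) * L ^ 2 ≤ q ^ n * L := by
    rw [← hU2]
    calc (S.card : ℝ) * L ^ 2 = ∑ r ∈ S, (∑ A ∈ I, ∏ P ∈ A, u P r) ^ 2 := by
          rw [sum_congr rfl fun r hr => by rw [hUS r hr], sum_const, nsmul_eq_mul]
      _ ≤ _ := sum_le_sum_of_subset_of_nonneg hS fun _ _ _ => sq_nonneg _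
  have : (S.card : ℝ) * L * L ≤ q ^ n * L := by nlinarith
  exact le_of_mul_le_mul_right this hL0

end LargeSieve

/-! ### Lower bound for the sieve density -/

section Density

variable {F : Type*} [Field F] [Fintype F]

open scoped Classical in
/-- The monic irreducible divisors of `f`. -/
noncomputable def primeDivisors {F : Type*} [Field F] (f : F[X]) : Finset F[X] :=
  (UniqueFactorizationMonoid.normalizedFactors f).toFinset

lemma mem_primeDivisors {K : Type*} [Field K] {f P : K[X]} (hf : f ≠ 0) :
    P ∈ primeDivisors f ↔ P.Monic ∧ Irreducible P ∧ P ∣ f := by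
  classical
  rw [primeDivisors, Multiset.mem_toFinset, UniqueFactorizationMonoid.mem_normalizedFactors_iff' hf]
  constructor
  · rintro ⟨h1, h2, h3⟩
    exact ⟨h2 ▸ monic_normalize h1.ne_zero, h1, h3⟩
  · rintro ⟨h1, h2, h3⟩
    exact ⟨h2, h1.normalize_eq_self, h3⟩

/-- `|f| / φ(f) = ∏_{P ∣ f} (1 - 1 / |P|)⁻¹`. -/
noncomputable def totientRatio (f : F[X]) : ℝ :=
  ∏ P ∈ primeDivisors f, (1 - 1 / (Fintype.card F : ℝ) ^ P.natDegree)⁻¹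

lemma two_le_card : (2 : ℝ) ≤ Fintype.card F := by
  exact_mod_cast (Fintype.one_lt_card : 1 < Fintype.card F)

lemma one_div_card_pow_lt_one {d : ℕ} (hd : d ≠ 0) : 1 / (Fintype.card F : ℝ) ^ d < 1 := by
  have := two_le_card (F := F)
  rw [div_lt_one (by positivity)]
  exact one_lt_pow₀ (by linarith) hd

lemma one_le_inv_one_sub {P : F[X]} (hP : Irreducible P) :
    1 ≤ (1 - 1 / (Fintype.card F : ℝ) ^ P.natDegree)⁻¹ := by
  have h1 := one_div_card_pow_lt_one (F := F) hP.natDegree_pos.ne'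
  have h2 : 0 ≤ 1 / (Fintype.card F : ℝ) ^ P.natDegree := by positivity
  exact (one_le_inv₀ (by linarith)).2 (by linarith)

/-- `f` has all its monic irreducible factors in `A`. -/
def IsSmoothOver {F : Type*} [Field F] (A : Finset F[X]) (f : F[X]) : Prop :=
  ∀ P : F[X], P.Monic → Irreducible P → P ∣ f → P ∈ A

open scoped Classical in
/-- The monic polynomials of degree `j` with all prime factors in `A`. -/
noncomputable def smoothDegree (A : Finset F[X]) (j : ℕ) : Finset F[X] :=
  (monicDegree F j).filter (IsSmoothOver A)

/-- The generating series of `1 / |f|` over the monic polynomials with all prime factors in `A`. -/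
noncomputable def zetaSeries (A : Finset F[X]) : PowerSeries ℝ :=
  PowerSeries.mk fun j => ((smoothDegree A j).card : ℝ) / (Fintype.card F : ℝ) ^ j

lemma mem_smoothDegree {A : Finset F[X]} {j : ℕ} {f : F[X]} :
    f ∈ smoothDegree A j ↔ f.Monic ∧ f.natDegree = j ∧ IsSmoothOver A f := by
  simp [smoothDegree, mem_monicDegree, and_assoc]

/-- Split by divisibility by `P`. The cofactor of a multiple of `P` may contain `P` again, hence the
larger set in the last term. -/
lemma card_smoothDegree_insert {A : Finset F[X]} {P : F[X]} [DecidableEq F[X]] (hPA : P ∉ A)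
    (hP : P.Monic) (hPi : Irreducible P) (j : ℕ) :
    (smoothDegree (insert P A) j).card = (smoothDegree A j).card +
      if P.natDegree ≤ j then (smoothDegree (insert P A) (j - P.natDegree)).card else 0 := by
  classical
  rw [← card_filter_add_card_filter_not (s := smoothDegree (insert P A) j) (fun f => ¬ P ∣ f)]
  congr 1
  · congr 1
    ext f
    simp only [mem_filter, mem_smoothDegree]
    constructor
    · rintro ⟨⟨h1, h2, h3⟩, h4⟩
      refine ⟨h1, h2, fun Q hQ hQi hQf => ?_⟩
      rcases mem_insert.1 (h3 Q hQ hQi hQf) with rfl | h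
      · exact absurd hQf h4
      · exact h
    · rintro ⟨h1, h2, h3⟩
      exact ⟨⟨h1, h2, fun Q hQ hQi hQf => mem_insert_of_mem (h3 Q hQ hQi hQf)⟩,
        fun h => hPA (h3 P hP hPi h)⟩
  · split_ifs with hj
    · refine card_nbij' (fun f => f /ₘ P) (fun f => P * f) ?_ ?_ ?_ ?_
      · intro f hf
        simp only [not_not, coe_filter, Set.mem_ofPred_eq, mem_smoothDegree] at hf
        obtain ⟨⟨h1, h2, h3⟩, g, rfl⟩ := hf
        have hg : g.Monic := hP.of_mul_monic_left h1
        rw [hP.natDegree_mul hg] at h2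
        rw [mem_coe, mem_smoothDegree]
        simp only [mul_divByMonic_cancel_left _ hP]
        exact ⟨hg, by omega, fun Q hQ hQi hQf => h3 Q hQ hQi (hQf.mul_left _)⟩
      · intro g hg
        rw [mem_coe, mem_smoothDegree] at hg
        obtain ⟨h1, h2, h3⟩ := hg
        simp only [not_not, coe_filter, Set.mem_ofPred_eq, mem_smoothDegree]
        refine ⟨⟨hP.mul h1, by rw [hP.natDegree_mul h1]; omega, fun Q hQ hQi hQf => ?_⟩,
          dvd_mul_right _ _⟩
        rcases hQi.prime.dvd_or_dvd hQf with h | h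
        · rw [eq_of_monic_of_associated hQ hP (hQi.associated_of_dvd hPi h)]
          exact mem_insert_self _ _
        · exact h3 Q hQ hQi h
      · intro f hf
        simp only [not_not, coe_filter, Set.mem_ofPred_eq] at hf
        obtain ⟨-, g, rfl⟩ := hf
        simp only [mul_divByMonic_cancel_left _ hP]
      · intro g _
        simp only [mul_divByMonic_cancel_left _ hP]
    · rw [card_eq_zero, filter_eq_empty_iff]
      intro f hf
      rw [mem_smoothDegree] at hf
      rw [not_not]
      intro h
      exact hj (hf.2.1 ▸ natDegree_le_of_dvd h hf.1.ne_zero)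

lemma coeff_mul_one_add (Y : PowerSeries ℝ) (c : ℝ) (d m : ℕ) :
    PowerSeries.coeff m (Y * (1 + PowerSeries.C c * PowerSeries.X ^ d))
      = PowerSeries.coeff m Y + if d ≤ m then c * PowerSeries.coeff (m - d) Y else 0 := by
  rw [mul_add, mul_one, map_add, mul_left_comm, PowerSeries.coeff_C_mul,
    PowerSeries.coeff_mul_X_pow']
  split_ifs <;> simp

lemma zetaSeries_insert {A : Finset F[X]} {P : F[X]} [DecidableEq F[X]] (hPA : P ∉ A)
    (hP : P.Monic) (hPi : Irreducible P) :
    zetaSeries (insert P A) *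
      (1 + PowerSeries.C (-(1 / (Fintype.card F : ℝ) ^ P.natDegree)) * PowerSeries.X ^ P.natDegree)
      = zetaSeries A := by
  have hq : (Fintype.card F : ℝ) ≠ 0 := by exact_mod_cast Fintype.card_ne_zero
  ext j
  rw [coeff_mul_one_add]
  simp only [zetaSeries, PowerSeries.coeff_mk]
  rw [card_smoothDegree_insert hPA hP hPi]
  split_ifs with h
  · have : (Fintype.card F : ℝ) ^ j = (Fintype.card F : ℝ) ^ P.natDegree *
        (Fintype.card F : ℝ) ^ (j - P.natDegree) := by rw [← pow_add]; congr 1; omega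
    rw [this]
    push_cast
    field_simp
    ring
  · simp

lemma zetaSeries_empty : zetaSeries (∅ : Finset F[X]) = 1 := by
  ext j
  rw [zetaSeries, PowerSeries.coeff_mk, PowerSeries.coeff_one]
  split_ifs with hj
  · subst hj
    have : smoothDegree (∅ : Finset F[X]) 0 = {1} := by
      ext f
      rw [mem_smoothDegree, mem_singleton]
      constructor
      · rintro ⟨h1, h2, -⟩
        exact eq_one_of_monic_natDegree_zero h1 h2
      · rintro rfl
        exact ⟨monic_one, natDegree_one, fun P _ hP h => absurd (isUnit_of_dvd_one h) hP.not_isUnit⟩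
    simp [this]
  · have : smoothDegree (∅ : Finset F[X]) j = ∅ := by
      rw [eq_empty_iff_forall_notMem]
      intro f hf
      rw [mem_smoothDegree] at hf
      obtain ⟨P, h1, h2, h3⟩ := exists_monic_irreducible_factor f (by
        intro hu
        exact hj (hf.2.1 ▸ natDegree_eq_zero_of_isUnit hu))
      simpa using hf.2.2 P h1 h2 h3
    simp [this]

lemma coeff_zetaSeries_nonneg (A : Finset F[X]) (j : ℕ) :
    0 ≤ PowerSeries.coeff j (zetaSeries A) := by
  rw [zetaSeries, PowerSeries.coeff_mk]; positivity

lemma coeff_zetaSeries_primesLE {m j : ℕ} (hj : j ≤ m) :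
    PowerSeries.coeff j (zetaSeries (primesLE F m)) = 1 := by
  have hq : (Fintype.card F : ℝ) ≠ 0 := by exact_mod_cast Fintype.card_ne_zero
  have : smoothDegree (primesLE F m) j = monicDegree F j := by
    ext f
    rw [mem_smoothDegree, mem_monicDegree]
    refine ⟨fun h => ⟨h.1, h.2.1⟩, fun h => ⟨h.1, h.2, fun P hP hPi hPf => ?_⟩⟩
    rw [mem_primesLE]
    refine ⟨hP, hPi, (natDegree_le_of_dvd hPf h.1.ne_zero).trans (by omega)⟩
  rw [zetaSeries, PowerSeries.coeff_mk, this, card_monicDegree]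
  push_cast
  exact div_self (pow_ne_zero _ hq)

lemma coeff_mk_one_mul (Y : PowerSeries ℝ) (m : ℕ) :
    PowerSeries.coeff m (PowerSeries.mk (fun _ => (1 : ℝ)) * Y)
      = ∑ k ∈ range (m + 1), PowerSeries.coeff k Y := by
  rw [mul_comm, PowerSeries.coeff_mul, Nat.sum_antidiagonal_eq_sum_range_succ_mk]
  simp

lemma coeff_mul_nonneg {Y Z : PowerSeries ℝ} (hY : ∀ k, 0 ≤ PowerSeries.coeff k Y)
    (hZ : ∀ k, 0 ≤ PowerSeries.coeff k Z) (m : ℕ) : 0 ≤ PowerSeries.coeff m (Y * Z) := by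
  rw [PowerSeries.coeff_mul]
  exact sum_nonneg fun p _ => mul_nonneg (hY _) (hZ _)

lemma monotone_coeff_mk_one_mul {Y : PowerSeries ℝ} (hY : ∀ k, 0 ≤ PowerSeries.coeff k Y) :
    Monotone fun m => PowerSeries.coeff m (PowerSeries.mk (fun _ => (1 : ℝ)) * Y) := by
  refine monotone_nat_of_le_succ fun m => ?_
  rw [coeff_mk_one_mul, coeff_mk_one_mul, sum_range_succ _ (m + 1)]
  linarith [hY (m + 1)]

/-- Unrolled, `y m` is the sum of `x ^ i * a (m - i * d)`. Monotonicity replaces each `a (m - i *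
d)` by `a m`, leaving a geometric series. -/
lemma le_div_of_geometric_recurrence {a y : ℕ → ℝ} {x : ℝ} {d : ℕ} (hd : 0 < d) (hx0 : 0 ≤ x)
    (hx1 : x < 1) (ha : Monotone a) (ha0 : ∀ m, 0 ≤ a m)
    (hy : ∀ m, y m = a m + if d ≤ m then x * y (m - d) else 0) (m : ℕ) :
    y m ≤ (1 - x)⁻¹ * a m := by
  induction m using Nat.strong_induction_on with
  | _ m ih =>
    have h1 : (0 : ℝ) < 1 - x := by linarith
    have hinv : (1 : ℝ) ≤ (1 - x)⁻¹ := (one_le_inv₀ h1).2 (by linarith)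
    rw [hy]
    split_ifs with hdm
    · have h2 := ih (m - d) (by omega)
      have h3 : a (m - d) ≤ a m := ha (Nat.sub_le _ _)
      calc a m + x * y (m - d) ≤ a m + x * ((1 - x)⁻¹ * a m) := by gcongr; exact h2.trans (by gcongr)
        _ = (1 - x)⁻¹ * a m := by field_simp; ring
    · nlinarith [ha0 m]

/-- The case of a prime not dividing `D`: passing from `a` to `z` inserts two Euler factors, which
are dominated by the single sieve factor `1 + h T ^ d`. The comparison of the coefficients of `a (m
- d)` leaves the surplus `x ^ 2 / ((1 - 2 * x) * (1 - x) ^ 2)`. -/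
lemma two_step_le {a y z : ℕ → ℝ} {x h : ℝ} {d : ℕ} (hd : 0 < d) (hx0 : 0 ≤ x) (hx1 : x < 1 / 2)
    (ha : Monotone a) (ha0 : ∀ m, 0 ≤ a m) (hym : Monotone y) (hy0 : ∀ m, 0 ≤ y m)
    (hy : ∀ m, y m = a m + if d ≤ m then x * y (m - d) else 0)
    (hz : ∀ m, z m = y m + if d ≤ m then x * z (m - d) else 0) (hh : h = 2 * x / (1 - 2 * x))
    (m : ℕ) : z m ≤ a m + if d ≤ m then h * a (m - d) else 0 := by
  have h1 : (0 : ℝ) < 1 - x := by linarith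
  have h2 : (0 : ℝ) < 1 - 2 * x := by linarith
  have hya := le_div_of_geometric_recurrence hd hx0 (by linarith) ha ha0 hy
  have hzy := le_div_of_geometric_recurrence hd hx0 (by linarith) hym hy0 hz
  rw [hz, hy m]
  split_ifs with hdm
  · have h3 : x * y (m - d) + x * z (m - d) ≤ h * a (m - d) := by
      have h4 : z (m - d) ≤ (1 - x)⁻¹ * ((1 - x)⁻¹ * a (m - d)) :=
        (hzy _).trans (by gcongr; exact hya _)
      have h5 : x * ((1 - x)⁻¹ + (1 - x)⁻¹ * (1 - x)⁻¹) ≤ h := by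
        rw [hh, ← sub_nonneg]
        have : 2 * x / (1 - 2 * x) - x * ((1 - x)⁻¹ + (1 - x)⁻¹ * (1 - x)⁻¹)
            = x ^ 2 / ((1 - 2 * x) * (1 - x) ^ 2) := by field_simp; ring
        rw [this]; positivity
      calc x * y (m - d) + x * z (m - d)
          ≤ x * ((1 - x)⁻¹ * a (m - d)) + x * ((1 - x)⁻¹ * ((1 - x)⁻¹ * a (m - d))) := by
            gcongr; exact hya _
        _ = x * ((1 - x)⁻¹ + (1 - x)⁻¹ * (1 - x)⁻¹) * a (m - d) := by ring
        _ ≤ h * a (m - d) := by gcongr; exact ha0 _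
    linarith
  · simp

/-- The case of a prime dividing `D`, with one forbidden class: one Euler factor is matched by the
sieve factor, the other costs `(1 - x)⁻¹`. These costs accumulate to `totientRatio D`. -/
lemma one_step_le {a y z : ℕ → ℝ} {x h : ℝ} {d : ℕ} (hd : 0 < d) (hx0 : 0 ≤ x) (hx1 : x < 1)
    (ha : Monotone a) (ha0 : ∀ m, 0 ≤ a m) (hym : Monotone y) (hy0 : ∀ m, 0 ≤ y m)
    (hy : ∀ m, y m = a m + if d ≤ m then x * y (m - d) else 0)
    (hz : ∀ m, z m = y m + if d ≤ m then x * z (m - d) else 0) (hh : h = x / (1 - x))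
    (m : ℕ) : z m ≤ (1 - x)⁻¹ * (a m + if d ≤ m then h * a (m - d) else 0) := by
  have h1 : (0 : ℝ) < 1 - x := by linarith
  have hya := le_div_of_geometric_recurrence hd hx0 hx1 ha ha0 hy
  have hzy := le_div_of_geometric_recurrence hd hx0 hx1 hym hy0 hz
  refine (hzy m).trans ?_
  rw [hy m]
  gcongr
  split_ifs with hdm
  · calc x * y (m - d) ≤ x * ((1 - x)⁻¹ * a (m - d)) := by gcongr; exact hya _
      _ = h * a (m - d) := by rw [hh]; ring
  · exact le_rfl

-- Primes are inserted one at a time. The factor `mk 1` turns coefficients into partial sums, and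
-- these are monotone, as `one_step_le` and `two_step_le` require.
open scoped Classical in
lemma coeff_zetaSeries_sq_le (D : F[X]) (A : Finset F[X])
    (hA : ∀ P ∈ A, P.Monic ∧ Irreducible P)
    (hω : ∀ P ∈ A, (if P ∣ D then 1 else 2) < Fintype.card F ^ P.natDegree) (m : ℕ) :
    PowerSeries.coeff m (PowerSeries.mk (fun _ => (1 : ℝ)) * (zetaSeries A * zetaSeries A))
      ≤ (∏ P ∈ A with P ∣ D, (1 - 1 / (Fintype.card F : ℝ) ^ P.natDegree)⁻¹) *
        PowerSeries.coeff m (PowerSeries.mk (fun _ => (1 : ℝ)) * ∏ P ∈ A,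
          (1 + PowerSeries.C (((if P ∣ D then 1 else 2 : ℕ) : ℝ) /
            ((Fintype.card F : ℝ) ^ P.natDegree - (if P ∣ D then 1 else 2 : ℕ))) *
              PowerSeries.X ^ P.natDegree)) := by
  induction A using Finset.induction_on generalizing m with
  | empty => simp [zetaSeries_empty]
  | insert P A hPA ih =>
    obtain ⟨hPm, hPi⟩ := hA P (mem_insert_self _ _)
    have ih := ih (fun Q hQ => hA Q (mem_insert_of_mem hQ)) fun Q hQ => hω Q (mem_insert_of_mem hQ)
    have hωP := hω P (mem_insert_self _ _)
    have hd : 0 < P.natDegree := hPi.natDegree_pos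
    have hq2 := two_le_card (F := F)
    set x : ℝ := 1 / (Fintype.card F : ℝ) ^ P.natDegree with hx
    have hx0 : 0 ≤ x := by positivity
    have hx1 : x < 1 := one_div_card_pow_lt_one hd.ne'
    have hqpos : 0 < (Fintype.card F : ℝ) ^ P.natDegree := by positivity
    have hrec := zetaSeries_insert hPA hPm hPi
    rw [← hx] at hrec
    set Z := zetaSeries A with hZ
    set Z' := zetaSeries (insert P A) with hZ'
    set E : PowerSeries ℝ := PowerSeries.mk fun _ => (1 : ℝ) with hE
    have hZ0 : ∀ k, 0 ≤ PowerSeries.coeff k Z := coeff_zetaSeries_nonneg A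
    have hZ0' : ∀ k, 0 ≤ PowerSeries.coeff k Z' := coeff_zetaSeries_nonneg _
    have hE0 : ∀ k, 0 ≤ PowerSeries.coeff k E := fun k => by simp [hE]
    set a : ℕ → ℝ := fun m => PowerSeries.coeff m (E * (Z * Z)) with ha
    set y : ℕ → ℝ := fun m => PowerSeries.coeff m (E * (Z' * Z)) with hy
    set z : ℕ → ℝ := fun m => PowerSeries.coeff m (E * (Z' * Z')) with hz
    have ham : Monotone a := monotone_coeff_mk_one_mul (coeff_mul_nonneg hZ0 hZ0)
    have hym : Monotone y := monotone_coeff_mk_one_mul (coeff_mul_nonneg hZ0' hZ0)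
    have ha0 : ∀ m, 0 ≤ a m := coeff_mul_nonneg hE0 (coeff_mul_nonneg hZ0 hZ0)
    have hy0 : ∀ m, 0 ≤ y m := coeff_mul_nonneg hE0 (coeff_mul_nonneg hZ0' hZ0)
    have hyrec : ∀ m, y m = a m + if P.natDegree ≤ m then x * y (m - P.natDegree) else 0 := by
      intro m
      have h : E * (Z * Z) = (E * (Z' * Z)) *
          (1 + PowerSeries.C (-x) * PowerSeries.X ^ P.natDegree) := by rw [← hrec]; ring
      simp only [ha, hy]
      rw [h, coeff_mul_one_add]
      split_ifs <;> ring
    have hzrec : ∀ m, z m = y m + if P.natDegree ≤ m then x * z (m - P.natDegree) else 0 := by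
      intro m
      have h : E * (Z' * Z) = (E * (Z' * Z')) *
          (1 + PowerSeries.C (-x) * PowerSeries.X ^ P.natDegree) := by rw [← hrec]; ring
      simp only [hz, hy]
      rw [h, coeff_mul_one_add]
      split_ifs <;> ring
    set h : ℝ := ((if P ∣ D then 1 else 2 : ℕ) : ℝ) /
            ((Fintype.card F : ℝ) ^ P.natDegree - (if P ∣ D then 1 else 2 : ℕ)) with hh
    have hgap : 0 < (Fintype.card F : ℝ) ^ P.natDegree - (if P ∣ D then 1 else 2 : ℕ) := by
      rw [sub_pos]; exact_mod_cast hωP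
    have hh0 : 0 ≤ h := div_nonneg (Nat.cast_nonneg _) hgap.le
    set W := ∏ P ∈ A, (1 + PowerSeries.C (((if P ∣ D then 1 else 2 : ℕ) : ℝ) /
            ((Fintype.card F : ℝ) ^ P.natDegree - (if P ∣ D then 1 else 2 : ℕ))) *
              PowerSeries.X ^ P.natDegree) with hW
    set c := ∏ P ∈ A with P ∣ D, (1 - 1 / (Fintype.card F : ℝ) ^ P.natDegree)⁻¹ with hc
    have hfin : a m + (if P.natDegree ≤ m then h * a (m - P.natDegree) else 0)
        ≤ c * (PowerSeries.coeff m (E * W) +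
          if P.natDegree ≤ m then h * PowerSeries.coeff (m - P.natDegree) (E * W) else 0) := by
      rw [mul_add]
      refine add_le_add (ih m) ?_
      split_ifs
      · rw [mul_left_comm]
        exact mul_le_mul_of_nonneg_left (ih _) hh0
      · simp
    rw [prod_insert hPA, mul_comm (1 + _) W, ← mul_assoc E W, coeff_mul_one_add, filter_insert]
    by_cases hPD : P ∣ D
    · rw [if_pos hPD, prod_insert (by simp [hPA]), mul_assoc]
      have h1 : h = x / (1 - x) := by
        simp only [hh, hPD, if_true, hx] at hgap ⊢
        push_cast at hgap ⊢
        field_simp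
      refine (one_step_le hd hx0 hx1 ham ha0 hym hy0 hyrec hzrec h1 m).trans ?_
      exact mul_le_mul_of_nonneg_left hfin (inv_nonneg.2 (by linarith))
    · rw [if_neg hPD]
      have h2 : (2 : ℝ) < (Fintype.card F : ℝ) ^ P.natDegree := by
        rw [if_neg hPD] at hωP; exact_mod_cast hωP
      have hx2 : x < 1 / 2 := by
        rw [hx]; exact one_div_lt_one_div_of_lt two_pos h2
      have h1 : h = 2 * x / (1 - 2 * x) := by
        have h3 : (Fintype.card F : ℝ) ^ P.natDegree - 2 ≠ 0 := by linarith
        simp only [hh, hPD, if_false, hx]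
        push_cast
        field_simp
      exact (two_step_le hd hx0 hx2 ham ha0 hym hy0 hyrec hzrec h1 m).trans hfin

open scoped Classical in
/-- Lower bound for the sieving density of the pair `(f, f + D)`. -/
theorem le_totientRatio_mul_sieve_sum {D : F[X]} (hD : D ≠ 0) (m : ℕ)
    (hω : ∀ P ∈ primesLE F m, (if P ∣ D then 1 else 2) < Fintype.card F ^ P.natDegree) :
    ((m : ℝ) + 1) * (m + 2) / 2 ≤ totientRatio D *
      ∑ A ∈ (primesLE F m).powerset with ∑ P ∈ A, P.natDegree ≤ m,
        ∏ P ∈ A, (((if P ∣ D then 1 else 2 : ℕ) : ℝ) /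
          ((Fintype.card F : ℝ) ^ P.natDegree - (if P ∣ D then 1 else 2 : ℕ))) := by
  have hprime : ∀ P ∈ primesLE F m, P.Monic ∧ Irreducible P := fun P hP =>
    ⟨(mem_primesLE.1 hP).1, (mem_primesLE.1 hP).2.1⟩
  have hmain := coeff_zetaSeries_sq_le D (primesLE F m) hprime hω m
  -- Up to degree `m` every monic polynomial is smooth, so the zeta series agrees with `(1 - T)⁻¹`
  -- there, and this is a coefficient of `(1 - T)⁻³`.
  have hleft : PowerSeries.coeff m (PowerSeries.mk (fun _ => (1 : ℝ)) *
      (zetaSeries (primesLE F m) * zetaSeries (primesLE F m))) = ((m : ℝ) + 1) * (m + 2) / 2 := by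
    rw [coeff_mk_one_mul]
    have h1 : ∀ k ∈ range (m + 1), PowerSeries.coeff k
        (zetaSeries (primesLE F m) * zetaSeries (primesLE F m)) = (k : ℝ) + 1 := by
      intro k hk
      rw [mem_range] at hk
      rw [PowerSeries.coeff_mul, sum_congr rfl (g := fun _ => (1 : ℝ))]
      · simp
      · intro p hp
        rw [HasAntidiagonal.mem_antidiagonal] at hp
        rw [coeff_zetaSeries_primesLE (by omega), coeff_zetaSeries_primesLE (by omega), mul_one]
    rw [sum_congr rfl h1]
    clear hω hprime hmain h1
    induction m with
    | zero => norm_num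
    | succ m ih => rw [sum_range_succ, ih]; push_cast; ring
  rw [hleft] at hmain
  -- Each `A` contributes a monomial of degree `∑ P ∈ A, P.natDegree`. The partial sum keeps those
  -- of degree at most `m`.
  have hright : PowerSeries.coeff m (PowerSeries.mk (fun _ => (1 : ℝ)) * ∏ P ∈ primesLE F m,
          (1 + PowerSeries.C (((if P ∣ D then 1 else 2 : ℕ) : ℝ) /
            ((Fintype.card F : ℝ) ^ P.natDegree - (if P ∣ D then 1 else 2 : ℕ))) *
              PowerSeries.X ^ P.natDegree)) =
      ∑ A ∈ (primesLE F m).powerset with ∑ P ∈ A, P.natDegree ≤ m,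
        ∏ P ∈ A, (((if P ∣ D then 1 else 2 : ℕ) : ℝ) /
          ((Fintype.card F : ℝ) ^ P.natDegree - (if P ∣ D then 1 else 2 : ℕ))) := by
    rw [prod_one_add, mul_sum, map_sum, sum_filter]
    refine sum_congr rfl fun A _ => ?_
    rw [prod_mul_distrib, ← map_prod, prod_pow_eq_pow_sum, mul_left_comm, PowerSeries.coeff_C_mul,
      PowerSeries.coeff_mul_X_pow']
    split_ifs <;> simp
  rw [hright] at hmain
  refine hmain.trans ?_
  refine mul_le_mul_of_nonneg_right ?_ ?_
  · rw [totientRatio]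
    refine prod_le_prod_of_subset_of_one_le ?_ ?_ ?_
    · intro P hP
      rw [mem_filter] at hP
      exact (mem_primeDivisors hD).2 ⟨(hprime P hP.1).1, (hprime P hP.1).2, hP.2⟩
    · intro P hP
      exact zero_le_one.trans (one_le_inv_one_sub (hprime P (mem_filter.1 hP).1).2)
    · intro P hP _
      exact one_le_inv_one_sub ((mem_primeDivisors hD).1 hP).2.1
  · refine sum_nonneg fun A hA => prod_nonneg fun P hP => div_nonneg (Nat.cast_nonneg _) ?_
    have hP' := mem_powerset.1 (mem_filter.1 hA).1 hP
    rw [sub_nonneg]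
    exact_mod_cast (hω P hP').le

end Density

/-! ### Exponentials of harmonic numbers -/

section Harmonic

open Real

/-- A crude bound, of slope 2 instead of `e ^ γ`, needed only in `exp_harmonic_step`. It fails at `L
= 1`, since `e > 8 / 3`, so the induction starts at 2. -/
lemma exp_harmonic_le_linear {L : ℕ} (hL : 2 ≤ L) : exp (harmonic L : ℝ) ≤ 2 * L + 2 / 3 := by
  induction L, hL using Nat.le_induction with
  | base =>
    have h1 : ((harmonic 2 : ℚ) : ℝ) = 3 / 2 := by
      rw [harmonic_succ, harmonic_succ, harmonic_zero]; norm_num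
    have h2 : exp (3 / 2 : ℝ) ^ 2 = exp 1 ^ 3 := by
      rw [← exp_nat_mul, ← exp_nat_mul]; norm_num
    have h3 : exp 1 ^ 3 ≤ (2.7182818286 : ℝ) ^ 3 := by gcongr; exact exp_one_lt_d9.le
    rw [h1]
    refine abs_le_of_sq_le_sq' ?_ (by norm_num) |>.2
    rw [h2]
    refine h3.trans ?_
    norm_num
  | succ L hL ih =>
    have hL' : (2 : ℝ) ≤ L := by exact_mod_cast hL
    rw [harmonic_succ]
    push_cast
    rw [exp_add]
    have h1 := exp_bound' (x := ((L : ℝ) + 1)⁻¹) (by positivity) (inv_le_one_of_one_le₀ (by linarith))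
      (n := 3) (by norm_num)
    simp only [sum_range_succ, range_zero, sum_empty, Nat.factorial] at h1
    norm_num at h1
    calc exp (harmonic L : ℝ) * exp ((L : ℝ) + 1)⁻¹
        ≤ (2 * L + 2 / 3) * (1 + ((L : ℝ) + 1)⁻¹ + (((L : ℝ) + 1) ^ 2)⁻¹ / 2 +
            (((L : ℝ) + 1) ^ 3)⁻¹ * 4 / 18) := by
          gcongr
      _ ≤ 2 * ((L : ℝ) + 1) + 2 / 3 := by
          rw [← sub_nonneg]
          have : 2 * ((L : ℝ) + 1) + 2 / 3 - (2 * L + 2 / 3) * (1 + ((L : ℝ) + 1)⁻¹ +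
              (((L : ℝ) + 1) ^ 2)⁻¹ / 2 + (((L : ℝ) + 1) ^ 3)⁻¹ * 4 / 18)
              = 1 / (3 * (L + 1)) + 2 / (9 * ((L : ℝ) + 1) ^ 2) + 8 / (27 * ((L : ℝ) + 1) ^ 3) := by
            field_simp
            ring
          rw [this]; positivity

/-- The claim reduces to `e ^ {H_L} (L + 1 - L e ^ {1 / (L + 1)}) ≤ 1`. The bracket is about `1 / (2
(L + 1))`, so slope 2 in the linear bound is just enough. -/
lemma exp_harmonic_step {L : ℕ} (hL : 1 ≤ L) :
    (exp (harmonic L : ℝ) - 1) / L ≤ (exp (harmonic (L + 1) : ℝ) - 1) / (L + 1 : ℕ) := by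
  have hL' : (1 : ℝ) ≤ L := by exact_mod_cast hL
  suffices h : exp (harmonic L : ℝ) * (L + 1 - L * exp (((L : ℝ) + 1)⁻¹)) ≤ 1 by
    rw [div_le_div_iff₀ (by positivity) (by positivity), harmonic_succ]
    push_cast
    rw [exp_add]
    nlinarith
  rcases hL.eq_or_lt with rfl | hL2
  · have h1 : ((harmonic 1 : ℚ) : ℝ) = 1 := by rw [harmonic_succ, harmonic_zero]; norm_num
    have h2 : (1.648 : ℝ) ≤ exp (2⁻¹ : ℝ) := by
      have := sum_le_exp_of_nonneg (x := (2⁻¹ : ℝ)) (by norm_num) 5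
      simp only [sum_range_succ, range_zero, sum_empty, Nat.factorial] at this
      norm_num at this ⊢
      linarith
    have h3 := exp_one_lt_d9
    have h4 := exp_pos (1 : ℝ)
    rw [h1]
    norm_num
    nlinarith
  · have h1 := exp_harmonic_le_linear hL2
    have h2 := sum_le_exp_of_nonneg (x := ((L : ℝ) + 1)⁻¹) (by positivity) 4
    simp only [sum_range_succ, range_zero, sum_empty, Nat.factorial] at h2
    norm_num at h2
    have h3 : (L : ℝ) + 1 - L * exp (((L : ℝ) + 1)⁻¹)
        ≤ 1 / (2 * ((L : ℝ) + 1)) + 1 / (3 * ((L : ℝ) + 1) ^ 2) + 1 / (6 * ((L : ℝ) + 1) ^ 3) := by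
      have h4 : (L : ℝ) * (1 + ((L : ℝ) + 1)⁻¹ + (((L : ℝ) + 1) ^ 2)⁻¹ / 2 +
          (((L : ℝ) + 1) ^ 3)⁻¹ / 6) ≤ L * exp (((L : ℝ) + 1)⁻¹) := by gcongr
      have h5 : (L : ℝ) + 1 - (L : ℝ) * (1 + ((L : ℝ) + 1)⁻¹ + (((L : ℝ) + 1) ^ 2)⁻¹ / 2 +
          (((L : ℝ) + 1) ^ 3)⁻¹ / 6)
          = 1 / (2 * ((L : ℝ) + 1)) + 1 / (3 * ((L : ℝ) + 1) ^ 2) + 1 / (6 * ((L : ℝ) + 1) ^ 3) := by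
        field_simp
        ring
      linarith
    calc exp (harmonic L : ℝ) * (L + 1 - L * exp (((L : ℝ) + 1)⁻¹))
        ≤ exp (harmonic L : ℝ) * (1 / (2 * ((L : ℝ) + 1)) + 1 / (3 * ((L : ℝ) + 1) ^ 2) +
          1 / (6 * ((L : ℝ) + 1) ^ 3)) := by gcongr
      _ ≤ (2 * L + 2 / 3) * (1 / (2 * ((L : ℝ) + 1)) + 1 / (3 * ((L : ℝ) + 1) ^ 2) +
          1 / (6 * ((L : ℝ) + 1) ^ 3)) := by gcongr
      _ ≤ 1 := by
        rw [← sub_nonneg]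
        have : 1 - (2 * (L : ℝ) + 2 / 3) * (1 / (2 * ((L : ℝ) + 1)) + 1 / (3 * ((L : ℝ) + 1) ^ 2) +
          1 / (6 * ((L : ℝ) + 1) ^ 3)) = 1 / (9 * ((L : ℝ) + 1) ^ 2) + 2 / (9 * ((L : ℝ) + 1) ^ 3) := by
          field_simp
          ring
        rw [this]; positivity

/-- `e ^ {H_L} ≤ 1 + e ^ γ L`. -/
theorem exp_harmonic_le (L : ℕ) :
    exp (harmonic L : ℝ) ≤ 1 + exp eulerMascheroniConstant * L := by
  rcases Nat.eq_zero_or_pos L with rfl | hL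
  · simp
  have hL' : (0 : ℝ) < L := by exact_mod_cast hL
  -- The sequence `(e ^ {H_n} - 1) / n` increases to `e ^ γ`, hence stays below it.
  have hlim : Filter.Tendsto (fun n : ℕ => (exp (harmonic n : ℝ) - 1) / n) Filter.atTop
      (nhds (exp eulerMascheroniConstant)) := by
    have h1 : Filter.Tendsto (fun n : ℕ => exp (eulerMascheroniSeq' n) - 1 / (n : ℝ)) Filter.atTop
        (nhds (exp eulerMascheroniConstant - 0)) :=
      ((continuous_exp.tendsto _).comp tendsto_eulerMascheroniSeq').sub
        tendsto_one_div_atTop_nhds_zero_nat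
    rw [sub_zero] at h1
    refine h1.congr' ?_
    filter_upwards [Filter.eventually_ge_atTop 1] with n hn
    have hn0 : n ≠ 0 := by omega
    have hn' : (0 : ℝ) < n := by exact_mod_cast hn
    rw [eulerMascheroniSeq', if_neg hn0, exp_sub, exp_log hn', sub_div]
  have hle : ∀ n, L ≤ n → (exp (harmonic L : ℝ) - 1) / L ≤ (exp (harmonic n : ℝ) - 1) / n := by
    intro n hn
    induction n, hn using Nat.le_induction with
    | base => exact le_rfl
    | succ n hn ih => exact ih.trans (exp_harmonic_step (by omega))
  have := ge_of_tendsto hlim (Filter.eventually_atTop.2 ⟨L, hle⟩)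
  rw [div_le_iff₀ hL'] at this
  linarith

end Harmonic

/-! ### Explicit Mertens bounds -/

section TotientBound

variable {F : Type*} [Field F] [Fintype F]

open Real

/-- `-log (1 - q ^ {-d})`, the contribution of a prime of degree `d` to `log (|f| / φ(f))`. -/
noncomputable def primeWeight (F : Type*) [Fintype F] (d : ℕ) : ℝ :=
  -log (1 - 1 / (Fintype.card F : ℝ) ^ d)

lemma primeWeight_nonneg (d : ℕ) : 0 ≤ primeWeight F d := by
  rcases Nat.eq_zero_or_pos d with rfl | hd
  · simp [primeWeight]
  have h1 := one_div_card_pow_lt_one (F := F) hd.ne'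
  have h2 : 0 ≤ 1 / (Fintype.card F : ℝ) ^ d := by positivity
  rw [primeWeight, neg_nonneg]
  exact log_nonpos (by linarith) (by linarith)

lemma primeWeight_anti {d e : ℕ} (hd : 1 ≤ d) (hde : d ≤ e) :
    primeWeight F e ≤ primeWeight F d := by
  have hq := two_le_card (F := F)
  have h1 := one_div_card_pow_lt_one (F := F) (d := d) (by omega)
  rw [primeWeight, primeWeight, neg_le_neg_iff]
  refine log_le_log (by linarith) ?_
  have : 1 / (Fintype.card F : ℝ) ^ e ≤ 1 / (Fintype.card F : ℝ) ^ d :=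
    one_div_le_one_div_of_le (by positivity) (pow_le_pow_right₀ (by linarith) hde)
  linarith

lemma mul_primeWeight_le {d : ℕ} (hd : 1 ≤ d) :
    ((Fintype.card F : ℝ) ^ d - 1) * primeWeight F d ≤ 1 := by
  have hq := two_le_card (F := F)
  have h1 : 1 < (Fintype.card F : ℝ) ^ d := one_lt_pow₀ (by linarith) (by omega)
  have h2 := one_div_card_pow_lt_one (F := F) (d := d) (by omega)
  have h3 : primeWeight F d ≤ (1 - 1 / (Fintype.card F : ℝ) ^ d)⁻¹ - 1 := by
    rw [primeWeight, ← log_inv]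
    exact log_le_sub_one_of_pos (inv_pos.2 (by linarith))
  calc ((Fintype.card F : ℝ) ^ d - 1) * primeWeight F d
      ≤ ((Fintype.card F : ℝ) ^ d - 1) * ((1 - 1 / (Fintype.card F : ℝ) ^ d)⁻¹ - 1) :=
        mul_le_mul_of_nonneg_left h3 (by linarith)
    _ = 1 := by
      have : (Fintype.card F : ℝ) ^ d - 1 ≠ 0 := by linarith
      field_simp
      ring

lemma log_totientRatio {f : F[X]} (hf : f ≠ 0) :
    log (totientRatio f) = ∑ P ∈ primeDivisors f, primeWeight F P.natDegree := by
  rw [totientRatio, log_prod]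
  · exact sum_congr rfl fun _ _ => by rw [log_inv, primeWeight]
  · intro _ hP
    have := one_le_inv_one_sub ((mem_primeDivisors hf).1 hP).2.1
    positivity

lemma totientRatio_pos (f : F[X]) (hf : f ≠ 0) : 0 < totientRatio f :=
  prod_pos fun _ hP => zero_lt_one.trans_le (one_le_inv_one_sub ((mem_primeDivisors hf).1 hP).2.1)

lemma one_le_totientRatio (f : F[X]) (hf : f ≠ 0) : 1 ≤ totientRatio f := by
  exact Finset.one_le_prod fun _ hP => one_le_inv_one_sub ((mem_primeDivisors hf).1 hP).2.1

lemma sum_natDegree_primeDivisors_le {K : Type*} [Field K] {f : K[X]} (hf : f ≠ 0) :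
    ∑ P ∈ primeDivisors f, P.natDegree ≤ f.natDegree := by
  rw [← natDegree_prod_of_monic _ _ fun P hP => ((mem_primeDivisors hf).1 hP).1]
  refine natDegree_le_of_dvd (Finset.prod_dvd_of_coprime ?_ fun P hP => ?_) hf
  · refine pairwise_isCoprime_primes fun P hP => ?_
    have := (mem_primeDivisors hf).1 hP
    exact ⟨this.1, this.2.1⟩
  · exact ((mem_primeDivisors hf).1 hP).2.2

/-- Degree `d ≥ 2` contributes at most `1 / d`. The `q` linear primes contribute at most `1 +
primeWeight F 1`, because `q - 1` of them weigh at most 1. -/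
lemma sum_primeWeight_primesLE {L : ℕ} :
    ∑ P ∈ primesLE F (L + 1), primeWeight F P.natDegree
      ≤ primeWeight F 1 + (harmonic (L + 1) : ℝ) := by
  have hq := two_le_card (F := F)
  have hdeg : ∀ d, ∑ P ∈ primesOfDegree F d, primeWeight F P.natDegree
      = (primesOfDegree F d).card * primeWeight F d := by
    intro d
    rw [sum_congr rfl fun P hP => by rw [(mem_primesOfDegree.1 hP).2.1], sum_const, nsmul_eq_mul]
  rw [sum_primesLE, sum_congr rfl fun d _ => hdeg d]
  induction L with
  | zero =>
    have h := mul_primeWeight_le (F := F) le_rfl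
    rw [harmonic_succ, harmonic_zero]
    simp only [zero_add, Icc_self, sum_singleton, card_primes_one]
    norm_num at h ⊢
    linarith
  | succ L ih =>
    rw [← Finset.insert_Icc_right_eq_Icc_add_one (by omega), sum_insert (by simp), harmonic_succ]
    have h1 := mul_card_primes_add_le (F := F) (n := L + 1 + 1) (by omega)
    have h2 := mul_primeWeight_le (F := F) (d := L + 1 + 1) (by omega)
    have h3 := primeWeight_nonneg (F := F) (L + 1 + 1)
    have h4 : ((L + 1 + 1 : ℕ) : ℝ) * (primesOfDegree F (L + 1 + 1)).card + Fintype.card F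
        ≤ (Fintype.card F : ℝ) ^ (L + 1 + 1) := by exact_mod_cast h1
    have h5 : ((primesOfDegree F (L + 1 + 1)).card : ℝ) * primeWeight F (L + 1 + 1)
        ≤ ((L + 1 + 1 : ℕ) : ℝ)⁻¹ := by
      rw [← one_div, le_div_iff₀ (by positivity)]
      nlinarith
    push_cast at h5 ⊢
    linarith

/-- A linear-programming bound for `log (|f| / φ(f))`. -/
lemma log_totientRatio_le (f : F[X]) (hf : f ≠ 0) (L : ℕ) :
    log (totientRatio f) ≤ primeWeight F 1 + harmonic L +
      ((f.natDegree : ℝ) - (Fintype.card F : ℝ) ^ L) * (primeWeight F (L + 1) / (L + 1 : ℕ)) := by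
  classical
  -- The dual price per unit of degree: primes of degree above `L` weigh at most `c` per unit of
  -- degree, the others at least `c`.
  set c := primeWeight F (L + 1) / (L + 1 : ℕ) with hc
  have hc0 : 0 ≤ c := div_nonneg (primeWeight_nonneg _) (Nat.cast_nonneg _)
  have hpt : ∀ P ∈ primeDivisors f, primeWeight F P.natDegree
      ≤ P.natDegree * c + if P ∈ primesLE F L then primeWeight F P.natDegree - P.natDegree * c
        else 0 := by
    intro P hP
    split_ifs with h
    · linarith
    · obtain ⟨h1, h2, -⟩ := (mem_primeDivisors hf).1 hP
      have h3 : L + 1 ≤ P.natDegree := by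
        by_contra! h4
        exact h (mem_primesLE.2 ⟨h1, h2, by omega⟩)
      have h4 : ((L + 1 : ℕ) : ℝ) ≤ P.natDegree := by exact_mod_cast h3
      have h5 : primeWeight F P.natDegree ≤ primeWeight F (L + 1) := primeWeight_anti (by omega) h3
      have h6 : primeWeight F (L + 1) = (L + 1 : ℕ) * c := by
        rw [hc]; field_simp
      rw [add_zero]
      refine h5.trans ?_
      rw [h6]
      gcongr
  have hpos : ∀ P ∈ primesLE F L, 0 ≤ primeWeight F P.natDegree - P.natDegree * c := by
    intro P hP
    obtain ⟨h1, h2, h3⟩ := mem_primesLE.1 hP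
    have h4 : primeWeight F (L + 1) ≤ primeWeight F P.natDegree :=
      primeWeight_anti h2.natDegree_pos (by omega)
    have h5 : (P.natDegree : ℝ) ≤ (L + 1 : ℕ) := by exact_mod_cast (by omega)
    have h6 : primeWeight F (L + 1) = (L + 1 : ℕ) * c := by
      rw [hc]; field_simp
    have : (P.natDegree : ℝ) * c ≤ (L + 1 : ℕ) * c := by gcongr
    linarith
  -- The primes of degree at most `L` have total degree at least `q ^ L`. For `L = 0` there are
  -- none, and `q ^ 0 * c` is `primeWeight F 1`.
  have hS : (Fintype.card F : ℝ) ^ L * c + ∑ P ∈ primesLE F L,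
      (primeWeight F P.natDegree - P.natDegree * c) ≤ primeWeight F 1 + harmonic L
       := by
    rcases Nat.eq_zero_or_pos L with rfl | hL
    · have : primesLE F 0 = ∅ := by
        simp [primesLE, primesOfDegree_zero]
      rw [this, harmonic_zero, hc]
      simp
    · obtain ⟨k, rfl⟩ : ∃ k, L = k + 1 := ⟨L - 1, by omega⟩
      have h1 := sum_primeWeight_primesLE (F := F) (L := k)
      have h2 := card_pow_le_sum_primes (F := F) (L := k + 1) (by omega)
      have h3 : ∑ P ∈ primesLE F (k + 1), P.natDegree
          = ∑ d ∈ Icc 1 (k + 1), d * (primesOfDegree F d).card := by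
        rw [sum_primesLE]
        refine sum_congr rfl fun d _ => ?_
        rw [sum_congr rfl fun P hP => (mem_primesOfDegree.1 hP).2.1, sum_const, smul_eq_mul,
          mul_comm]
      rw [← h3] at h2
      have h4 : (Fintype.card F : ℝ) ^ (k + 1) ≤ ∑ P ∈ primesLE F (k + 1), (P.natDegree : ℝ) := by
        exact_mod_cast h2
      rw [sum_sub_distrib, ← sum_mul]
      nlinarith
  have hdeg : ∑ P ∈ primeDivisors f, (P.natDegree : ℝ) ≤ f.natDegree := by
    exact_mod_cast sum_natDegree_primeDivisors_le hf
  rw [log_totientRatio hf]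
  calc ∑ P ∈ primeDivisors f, primeWeight F P.natDegree
      ≤ ∑ P ∈ primeDivisors f, (P.natDegree * c + if P ∈ primesLE F L then
          primeWeight F P.natDegree - P.natDegree * c else 0) := sum_le_sum hpt
    _ = (∑ P ∈ primeDivisors f, (P.natDegree : ℝ)) * c +
        ∑ P ∈ primeDivisors f with P ∈ primesLE F L,
          (primeWeight F P.natDegree - P.natDegree * c) := by
        rw [sum_add_distrib, sum_mul, sum_filter]
    _ ≤ f.natDegree * c + ∑ P ∈ primesLE F L, (primeWeight F P.natDegree - P.natDegree * c) := by
        refine add_le_add (by gcongr) (sum_le_sum_of_subset_of_nonneg ?_ fun P hP _ => hpos P hP)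
        intro P hP
        exact (mem_filter.1 hP).2
    _ ≤ _ := by linarith

lemma exp_primeWeight_one :
    exp (primeWeight F 1) = (Fintype.card F : ℝ) / ((Fintype.card F : ℝ) - 1) := by
  have hq := two_le_card (F := F)
  have h := one_div_card_pow_lt_one (F := F) one_ne_zero
  rw [primeWeight, exp_neg, exp_log (by linarith), pow_one]
  have : (Fintype.card F : ℝ) - 1 ≠ 0 := by linarith
  field_simp

/-- `|f| / φ(f) ≤ q / (q - 1) * (1 + e ^ γ * deg f / q)` when `1 ≤ deg f ≤ q`. -/
lemma totientRatio_le_of_natDegree_le {f : F[X]} (hf : f ≠ 0)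
    (hfq : f.natDegree ≤ Fintype.card F) :
    totientRatio f ≤ (Fintype.card F : ℝ) / ((Fintype.card F : ℝ) - 1) *
      (1 + exp eulerMascheroniConstant * ((f.natDegree : ℝ) / Fintype.card F)) := by
  have hq := two_le_card (F := F)
  have hfq' : (f.natDegree : ℝ) ≤ Fintype.card F := by exact_mod_cast hfq
  have h1 := log_totientRatio_le f hf 0
  have h2 := mul_primeWeight_le (F := F) le_rfl
  set t : ℝ := (f.natDegree : ℝ) / Fintype.card F with ht
  have ht0 : 0 ≤ t := by positivity
  have ht1 : t ≤ 1 := by rw [ht, div_le_one (by linarith)]; exact hfq'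
  have hw := primeWeight_nonneg (F := F) 1
  have h3 : log (totientRatio f) ≤ primeWeight F 1 + t := by
    rw [harmonic_zero] at h1
    norm_num at h1 h2
    have h4 : ((f.natDegree : ℝ) - 1) * primeWeight F 1 ≤ t := by
      have hft : (f.natDegree : ℝ) = t * Fintype.card F := by
        rw [ht]; field_simp
      rw [hft]
      have : t * ((Fintype.card F : ℝ) - 1) * primeWeight F 1 ≤ t := by
        nlinarith
      nlinarith
    linarith
  -- The chord of `exp` over `[0, 1]`, whose slope `e - 1` is at most `e ^ γ` by the case `L = 1` of
  -- `exp_harmonic_le`.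
  have h5 : exp t ≤ 1 + exp eulerMascheroniConstant * t := by
    have h6 := exp_harmonic_le 1
    have h7 : ((harmonic 1 : ℚ) : ℝ) = 1 := by rw [harmonic_succ, harmonic_zero]; norm_num
    rw [h7] at h6
    have h8 := convexOn_exp.2 (Set.mem_univ 0) (Set.mem_univ 1) (sub_nonneg.2 ht1) ht0 (by ring)
    simp only [smul_eq_mul, mul_zero, mul_one, zero_add, exp_zero] at h8
    norm_num at h6
    nlinarith
  rw [← exp_log (totientRatio_pos f hf)]
  refine (exp_le_exp.2 h3).trans ?_
  rw [exp_add, exp_primeWeight_one]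
  exact mul_le_mul_of_nonneg_left h5 (div_nonneg (by linarith) (by linarith))

/-- An explicit form of Mertens' upper bound for `|f| / φ(f)`. -/
theorem totientRatio_le {f : F[X]} (hf : 1 ≤ f.natDegree) :
    totientRatio f ≤ (Fintype.card F : ℝ) / ((Fintype.card F : ℝ) - 1) *
      (1 + exp eulerMascheroniConstant * (log f.natDegree / log (Fintype.card F))) := by
  have hf0 : f ≠ 0 := by rintro rfl; simp at hf
  have hq := two_le_card (F := F)
  set q : ℝ := (Fintype.card F : ℝ) with hqdef
  have hq1 : 0 < log q := log_pos (by linarith)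
  set L := Nat.log (Fintype.card F) f.natDegree with hL
  have hm1 : q ^ L ≤ f.natDegree := by
    rw [hqdef]; exact_mod_cast Nat.pow_log_le_self (Fintype.card F) (by omega)
  have hm2 : (f.natDegree : ℝ) ≤ q ^ (L + 1) := by
    rw [hqdef]; exact_mod_cast (Nat.lt_pow_succ_log_self Fintype.one_lt_card f.natDegree).le
  set m : ℝ := (f.natDegree : ℝ) with hm
  have hqL : 0 < q ^ L := by positivity
  have hgap : 0 < q ^ (L + 1) - q ^ L := by rw [pow_succ]; nlinarith
  -- The position of the degree between `q ^ L` and `q ^ (L + 1)`. Concavity of `log` gives both `L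
  -- + t ≤ log m / log q` and the interpolated form of `exp_harmonic_le`.
  set t := (m - q ^ L) / (q ^ (L + 1) - q ^ L) with ht
  have ht0 : 0 ≤ t := div_nonneg (by linarith) hgap.le
  have ht1 : t ≤ 1 := by rw [ht, div_le_one hgap]; linarith
  have hmt : m - q ^ L = t * (q ^ (L + 1) - q ^ L) := by rw [ht]; field_simp
  set G := exp eulerMascheroniConstant with hG
  have hG0 : 0 < G := exp_pos _
  have h1 : log (totientRatio f) ≤ primeWeight F 1 + ((1 - t) * harmonic L + t * harmonic (L + 1)) := by
    refine (log_totientRatio_le f hf0 L).trans ?_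
    have h2 := mul_primeWeight_le (F := F) (d := L + 1) (by omega)
    have h3 := primeWeight_nonneg (F := F) (L + 1)
    have hq1L : 1 ≤ q ^ L := one_le_pow₀ (by linarith)
    have h4 : (m - q ^ L) * primeWeight F (L + 1) ≤ t := by
      rw [hmt]
      have : (q ^ (L + 1) - q ^ L) * primeWeight F (L + 1) ≤ 1 :=
        le_trans (mul_le_mul_of_nonneg_right (by linarith) h3) h2
      nlinarith
    rw [harmonic_succ]
    push_cast
    have h5 : (m - q ^ L) * (primeWeight F (L + 1) / ((L : ℝ) + 1)) ≤ t * ((L : ℝ) + 1)⁻¹ := by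
      rw [← div_eq_mul_inv, ← mul_div_assoc]; gcongr
    linarith
  have h2 : (L : ℝ) + t ≤ log m / log q := by
    rw [le_div_iff₀ hq1]
    have h3 := strictConcaveOn_log_Ioi.concaveOn.2 (x := q ^ L) (y := q ^ (L + 1)) hqL
      (Set.mem_Ioi.2 (by positivity)) (sub_nonneg.2 ht1) ht0 (by ring)
    simp only [smul_eq_mul, log_pow] at h3
    have h4 : (1 - t) * q ^ L + t * q ^ (L + 1) = m := by linarith
    rw [h4] at h3
    push_cast at h3
    linarith
  have h3 : (1 - t) * harmonic L + t * harmonic (L + 1) ≤ log (1 + G * (L + t)) := by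
    have ha : (0 : ℝ) < 1 + G * L := by positivity
    have hb : (0 : ℝ) < 1 + G * (L + 1 : ℕ) := by positivity
    have h4 := strictConcaveOn_log_Ioi.concaveOn.2 (x := 1 + G * L) (y := 1 + G * (L + 1 : ℕ)) ha hb
      (sub_nonneg.2 ht1) ht0 (by ring)
    simp only [smul_eq_mul] at h4
    have h5 : (harmonic L : ℝ) ≤ log (1 + G * L) := (le_log_iff_exp_le ha).2 (exp_harmonic_le L)
    have h6 : (harmonic (L + 1) : ℝ) ≤ log (1 + G * (L + 1 : ℕ)) :=
      (le_log_iff_exp_le hb).2 (exp_harmonic_le (L + 1))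
    have h7 : (1 - t) * (1 + G * L) + t * (1 + G * (L + 1 : ℕ)) = 1 + G * (L + t) := by
      push_cast; ring
    rw [h7] at h4
    refine le_trans ?_ h4
    gcongr
  rw [← exp_log (totientRatio_pos f hf0)]
  refine (exp_le_exp.2 (h1.trans (by gcongr))).trans (?_ : exp (primeWeight F 1 + log (1 + G * (L + t))) ≤ _)
  rw [exp_add, exp_primeWeight_one, exp_log (by positivity)]
  refine mul_le_mul_of_nonneg_left ?_ (div_nonneg (by linarith) (by linarith))
  gcongr

end TotientBound

/-! ### Averages of products governed by divisibility -/

section Averages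

/-- Raising the cutoff from `Y` to `Y + 1` adds the number of multiples of `e` up to `Y + 1`, which
is at most `(Y + 1) / e`. There is no multiple in range if `e = 0` or `e > X`. -/
lemma sum_multiples_le (e X : ℕ) :
    ∑ j ∈ Icc 1 X with e ∣ j, ((X : ℝ) + 1 - j)
      ≤ if 1 ≤ e ∧ e ≤ X then (X : ℝ) * (X + 1) / 2 * (1 / e) else 0 := by
  split_ifs with he
  · have he0 : (0 : ℝ) < e := by exact_mod_cast he.1
    have hmain : ∀ Y : ℕ, ∑ j ∈ Icc 1 Y with e ∣ j, ((Y : ℝ) + 1 - j)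
        ≤ (Y : ℝ) * (Y + 1) / 2 * (1 / e) := by
      intro Y
      induction Y with
      | zero => simp
      | succ Y ih =>
        have h1 : ∑ j ∈ Icc 1 (Y + 1) with e ∣ j, (((Y + 1 : ℕ) : ℝ) + 1 - j)
            = ((Icc 1 (Y + 1)).filter (e ∣ ·)).card +
              ∑ j ∈ Icc 1 (Y + 1) with e ∣ j, ((Y : ℝ) + 1 - j) := by
          rw [card_eq_sum_ones, Nat.cast_sum, ← sum_add_distrib]
          refine sum_congr rfl fun j _ => ?_
          push_cast; ring
        have h2 : ∑ j ∈ Icc 1 (Y + 1) with e ∣ j, ((Y : ℝ) + 1 - j)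
            = ∑ j ∈ Icc 1 Y with e ∣ j, ((Y : ℝ) + 1 - j) := by
          rw [sum_filter, sum_filter, ← Finset.insert_Icc_right_eq_Icc_add_one (by omega),
            sum_insert (by simp)]
          simp
        have h3 : (((Icc 1 (Y + 1)).filter (e ∣ ·)).card : ℝ) ≤ ((Y : ℝ) + 1) * (1 / e) := by
          have : Icc 1 (Y + 1) = Ioc 0 (Y + 1) := rfl
          rw [this, Nat.Ioc_filter_dvd_card_eq_div, mul_one_div]
          have := Nat.cast_div_le (α := ℝ) (m := Y + 1) (n := e)
          push_cast at this ⊢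
          exact this
        rw [h1, h2]
        push_cast
        nlinarith
    exact hmain X
  · refine le_of_eq (sum_eq_zero fun j hj => ?_)
    rw [mem_filter, mem_Icc] at hj
    exfalso
    refine he ⟨?_, (Nat.le_of_dvd hj.1.1 hj.2).trans hj.1.2⟩
    exact Nat.pos_of_dvd_of_pos hj.2 hj.1.1

lemma one_div_eq_sum_Ico {e X : ℕ} (he : 1 ≤ e) (heX : e ≤ X) :
    (1 : ℝ) / e = ∑ x ∈ Ico e X, 1 / ((x : ℝ) * (x + 1)) + 1 / X := by
  induction X, heX using Nat.le_induction with
  | base => simp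
  | succ X hX ih =>
    have hX0 : (0 : ℝ) < X := by exact_mod_cast (by omega : 0 < X)
    rw [sum_Ico_succ_top hX, ih]
    push_cast
    field_simp
    ring

/-- Expand the product over subsets `A`; the conditions `e i ∣ j` combine into `A.lcm e ∣ j`,
satisfied with weighted proportion at most `1 / A.lcm e`. Telescoping this reciprocal
(`one_div_eq_sum_Ico`) groups the subsets by `A.lcm e ≤ x`. Then every `e i` is at most `x`, so the
group is part of the expansion of the product over `e i ≤ x`. -/
lemma weighted_sum_prod_le {ι : Type*} [DecidableEq ι] (s : Finset ι) (e : ι → ℕ) (w : ι → ℝ)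
    (hw : ∀ i ∈ s, 0 ≤ w i) {X : ℕ} (hX : 1 ≤ X) :
    ∑ j ∈ Icc 1 X, ((X : ℝ) + 1 - j) * ∏ i ∈ s with e i ∣ j, (1 + w i)
      ≤ (X : ℝ) * (X + 1) / 2 *
        (∑ x ∈ Ico 1 X, (∏ i ∈ s with 1 ≤ e i ∧ e i ≤ x, (1 + w i)) / ((x : ℝ) * (x + 1)) +
          (∏ i ∈ s with 1 ≤ e i ∧ e i ≤ X, (1 + w i)) / X) := by
  set W : Finset ι → ℝ := fun A => ∏ i ∈ A, w i with hW
  have hW0 : ∀ A ∈ s.powerset, 0 ≤ W A := fun A hA =>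
    prod_nonneg fun i hi => hw i (mem_powerset.1 hA hi)
  have hS : ∀ j, ∏ i ∈ s with e i ∣ j, (1 + w i)
      = ∑ A ∈ s.powerset, if A.lcm e ∣ j then W A else 0 := by
    intro j
    rw [prod_one_add, ← sum_filter]
    refine sum_congr ?_ fun _ _ => rfl
    ext A
    simp only [mem_powerset, mem_filter, Finset.lcm_dvd_iff, subset_iff]
    constructor
    · exact fun h => ⟨fun i hi => (h hi).1, fun i hi => (h hi).2⟩
    · exact fun h i hi => ⟨h.1 hi, h.2 i hi⟩
  have hB : ∀ x : ℕ, ∑ A ∈ s.powerset with 1 ≤ A.lcm e ∧ A.lcm e ≤ x, W A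
      ≤ ∏ i ∈ s with 1 ≤ e i ∧ e i ≤ x, (1 + w i) := by
    intro x
    rw [prod_one_add]
    refine sum_le_sum_of_subset_of_nonneg ?_ ?_
    · intro A hA
      rw [mem_filter, mem_powerset] at hA
      rw [mem_powerset]
      intro i hi
      have h1 : e i ∣ A.lcm e := dvd_lcm hi
      exact mem_filter.2 ⟨hA.1 hi, Nat.pos_of_dvd_of_pos h1 hA.2.1,
        (Nat.le_of_dvd hA.2.1 h1).trans hA.2.2⟩
    · intro A hA _
      exact prod_nonneg fun i hi => hw i (mem_filter.1 (mem_powerset.1 hA hi)).1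
  have h1 : ∑ j ∈ Icc 1 X, ((X : ℝ) + 1 - j) * ∏ i ∈ s with e i ∣ j, (1 + w i)
      = ∑ A ∈ s.powerset, W A * ∑ j ∈ Icc 1 X with A.lcm e ∣ j, ((X : ℝ) + 1 - j) := by
    simp_rw [hS, mul_sum]
    rw [sum_comm]
    refine sum_congr rfl fun A _ => ?_
    rw [sum_filter]
    refine sum_congr rfl fun j _ => ?_
    split_ifs <;> ring
  have h2 : ∀ A : Finset ι, (if 1 ≤ A.lcm e ∧ A.lcm e ≤ X then (1 : ℝ) / (A.lcm e : ℕ) else 0)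
      = ∑ x ∈ Ico 1 X, (if 1 ≤ A.lcm e ∧ A.lcm e ≤ x then 1 / ((x : ℝ) * (x + 1)) else 0) +
        if 1 ≤ A.lcm e ∧ A.lcm e ≤ X then (1 : ℝ) / X else 0 := by
    intro A
    split_ifs with h
    · rw [one_div_eq_sum_Ico h.1 h.2, ← sum_filter]
      congr 1
      refine sum_congr ?_ fun _ _ => rfl
      ext x
      simp only [mem_filter, mem_Ico]
      omega
    · rw [add_zero, eq_comm]
      refine sum_eq_zero fun x hx => ?_
      rw [mem_Ico] at hx
      rw [if_neg]
      omega
  calc _ = _ := h1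
    _ ≤ ∑ A ∈ s.powerset, W A * (if 1 ≤ A.lcm e ∧ A.lcm e ≤ X then
          (X : ℝ) * (X + 1) / 2 * (1 / (A.lcm e : ℕ)) else 0) :=
        sum_le_sum fun A hA => mul_le_mul_of_nonneg_left (sum_multiples_le _ _) (hW0 A hA)
    _ = (X : ℝ) * (X + 1) / 2 * ∑ A ∈ s.powerset, W A *
          (if 1 ≤ A.lcm e ∧ A.lcm e ≤ X then (1 : ℝ) / (A.lcm e : ℕ) else 0) := by
        rw [mul_sum]
        refine sum_congr rfl fun A _ => ?_
        split_ifs <;> ring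
    _ = (X : ℝ) * (X + 1) / 2 *
        (∑ x ∈ Ico 1 X, (∑ A ∈ s.powerset with 1 ≤ A.lcm e ∧ A.lcm e ≤ x, W A) / ((x : ℝ) * (x + 1))
          + (∑ A ∈ s.powerset with 1 ≤ A.lcm e ∧ A.lcm e ≤ X, W A) / X) := by
        congr 1
        simp_rw [h2, mul_add, sum_add_distrib]
        congr 1
        · simp_rw [mul_sum]
          rw [sum_comm]
          refine sum_congr rfl fun x _ => ?_
          rw [sum_filter, sum_div]
          refine sum_congr rfl fun A _ => ?_
          split_ifs <;> ring
        · rw [sum_filter, sum_div]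
          refine sum_congr rfl fun A _ => ?_
          split_ifs <;> ring
    _ ≤ _ := by
        gcongr with x
        · exact hB x
        · exact hB X

end Averages

/-! ### Orders of `g` modulo primes -/

section Romanoff

variable {F : Type*} [Field F]

/-- A polynomial divisible by every prime dividing `g` or `g ^ j - 1` for some `1 ≤ j ≤ x`. -/
noncomputable def orderPoly (g : F[X]) (x : ℕ) : F[X] :=
  g * ((g - 1) * ∏ j ∈ range x, ∑ i ∈ range (j + 1), g ^ i)

lemma natDegree_pow_sub_one (g : F[X]) (j : ℕ) : (g ^ j - 1).natDegree = j * g.natDegree := by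
  rw [← C_1, natDegree_sub_C, natDegree_pow]

lemma pow_sub_one_ne_zero {g : F[X]} (hg : 1 ≤ g.natDegree) {j : ℕ} (hj : 1 ≤ j) :
    g ^ j - 1 ≠ 0 := by
  intro h
  have h1 := natDegree_pow_sub_one g j
  rw [h, natDegree_zero, eq_comm, Nat.mul_eq_zero] at h1
  omega

lemma natDegree_geom_sum {g : F[X]} (hg : 1 ≤ g.natDegree) (j : ℕ) :
    (∑ i ∈ range (j + 1), g ^ i).natDegree = j * g.natDegree := by
  have h1 := mul_geom_sum g (j + 1)
  have h0 := pow_sub_one_ne_zero hg (j := j + 1) (by omega)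
  have h2 : (∑ i ∈ range (j + 1), g ^ i) ≠ 0 := by
    rintro h; rw [h, mul_zero] at h1; exact h0 h1.symm
  have h3 : g - 1 ≠ 0 := by
    rintro h; rw [h, zero_mul] at h1; exact h0 h1.symm
  have h4 := natDegree_mul h3 h2
  have h5 := natDegree_pow_sub_one g 1
  rw [pow_one] at h5
  rw [h1, natDegree_pow_sub_one, h5] at h4
  nlinarith

lemma geom_sum_ne_zero_of_natDegree {g : F[X]} (hg : 1 ≤ g.natDegree) (j : ℕ) :
    ∑ i ∈ range (j + 1), g ^ i ≠ 0 := by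
  have h1 := mul_geom_sum g (j + 1)
  rintro h
  rw [h, mul_zero] at h1
  exact pow_sub_one_ne_zero hg (j := j + 1) (by omega) h1.symm

lemma orderPoly_ne_zero {g : F[X]} (hg : 1 ≤ g.natDegree) (x : ℕ) : orderPoly g x ≠ 0 := by
  have h1 := pow_sub_one_ne_zero hg le_rfl
  rw [pow_one] at h1
  refine mul_ne_zero ?_ (mul_ne_zero h1 (prod_ne_zero_iff.2 fun j _ =>
    geom_sum_ne_zero_of_natDegree hg j))
  rintro rfl
  simp at hg

/-- The factor `g - 1` common to all `g ^ j - 1` is counted only once. This is why the quadratic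
term is `x * (x - 1) / 2`. -/
lemma natDegree_orderPoly {g : F[X]} (hg : 1 ≤ g.natDegree) (x : ℕ) :
    ((orderPoly g x).natDegree : ℝ) = g.natDegree * (2 + (x : ℝ) * (x - 1) / 2) := by
  have hg0 : g ≠ 0 := by rintro rfl; simp at hg
  have h1 := pow_sub_one_ne_zero hg le_rfl
  have h5 := natDegree_pow_sub_one g 1
  rw [pow_one] at h1 h5
  have hP : ∏ j ∈ range x, ∑ i ∈ range (j + 1), g ^ i ≠ 0 :=
    prod_ne_zero_iff.2 fun j _ => geom_sum_ne_zero_of_natDegree hg j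
  rw [orderPoly, natDegree_mul hg0 (mul_ne_zero h1 hP), natDegree_mul h1 hP, h5,
    natDegree_prod _ _ fun j _ => geom_sum_ne_zero_of_natDegree hg j,
    sum_congr rfl fun j _ => natDegree_geom_sum hg j, ← sum_mul]
  have h6 : (∑ j ∈ range x, (j : ℝ)) = (x : ℝ) * (x - 1) / 2 := by
    clear hP
    induction x with
    | zero => simp
    | succ x ih => rw [sum_range_succ, ih]; push_cast; ring
  push_cast
  rw [h6]
  ring

open scoped Classical in
/-- The order of `g` modulo `P`, or `1` if `P` divides `g`. -/
noncomputable def orderModulo (g P : F[X]) : ℕ :=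
  if P ∣ g then 1 else orderOf (AdjoinRoot.mk P g)

/-- The value 1 assigned to primes dividing `g` lets one divisibility criterion cover both cases. -/
lemma dvd_mul_pow_sub_one_iff {g P : F[X]} (hP : Irreducible P) (j : ℕ) :
    P ∣ g * (g ^ j - 1) ↔ orderModulo g P ∣ j := by
  rw [orderModulo]
  split_ifs with h
  · simp [h.mul_right]
  · rw [orderOf_dvd_iff_pow_eq_one, hP.prime.dvd_mul, or_iff_right h, ← map_pow, ← sub_eq_zero,
      ← map_one (AdjoinRoot.mk P), ← map_sub, AdjoinRoot.mk_eq_zero]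

lemma dvd_orderPoly {g P : F[X]} (hP : Irreducible P) {x : ℕ} (h1 : 1 ≤ orderModulo g P)
    (hx : orderModulo g P ≤ x) : P ∣ orderPoly g x := by
  rcases hP.prime.dvd_or_dvd ((dvd_mul_pow_sub_one_iff hP _).2 (dvd_refl (orderModulo g P))) with h | h
  · exact h.mul_right _
  · obtain ⟨k, hk⟩ : ∃ k, orderModulo g P = k + 1 := ⟨orderModulo g P - 1, by omega⟩
    rw [hk, ← mul_geom_sum] at h
    refine (h.trans ?_).mul_left _
    exact mul_dvd_mul_left _ (dvd_prod_of_mem (fun j => ∑ i ∈ range (j + 1), g ^ i)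
      (mem_range.2 (by omega)))

variable [Fintype F]

/-- The mean value of `|D| / φ(D)` over `D = g (g ^ j - 1)`. -/
theorem sum_totientRatio_le {g : F[X]} (hg : 1 ≤ g.natDegree) {X : ℕ} (hX : 1 ≤ X) :
    ∑ j ∈ Icc 1 X, ((X : ℝ) + 1 - j) * totientRatio (g * (g ^ j - 1))
      ≤ (X : ℝ) * (X + 1) / 2 *
        (∑ x ∈ Ico 1 X, totientRatio (orderPoly g x) / ((x : ℝ) * (x + 1)) +
          totientRatio (orderPoly g X) / X) := by
  classical
  have hg0 : g ≠ 0 := by rintro rfl; simp at hg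
  have hD0 : ∀ j, 1 ≤ j → g * (g ^ j - 1) ≠ 0 := fun j hj =>
    mul_ne_zero hg0 (pow_sub_one_ne_zero hg hj)
  set s := (Icc 1 X).biUnion fun j => primeDivisors (g * (g ^ j - 1)) with hs
  have hsi : ∀ P ∈ s, P.Monic ∧ Irreducible P := by
    intro P hP
    obtain ⟨j, hj, hPj⟩ := mem_biUnion.1 hP
    have := (mem_primeDivisors (hD0 j (mem_Icc.1 hj).1)).1 hPj
    exact ⟨this.1, this.2.1⟩
  set w : F[X] → ℝ := fun P => (1 - 1 / (Fintype.card F : ℝ) ^ P.natDegree)⁻¹ - 1 with hw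
  have hw1 : ∀ P, 1 + w P = (1 - 1 / (Fintype.card F : ℝ) ^ P.natDegree)⁻¹ := fun P => by
    rw [hw]; ring
  have hw0 : ∀ P ∈ s, 0 ≤ w P := fun P hP => sub_nonneg.2 (one_le_inv_one_sub (hsi P hP).2)
  have hL : ∀ j ∈ Icc 1 X, totientRatio (g * (g ^ j - 1))
      = ∏ P ∈ s with orderModulo g P ∣ j, (1 + w P) := by
    intro j hj
    rw [totientRatio, prod_congr rfl fun P _ => hw1 P]
    refine prod_congr ?_ fun _ _ => rfl
    ext P
    rw [mem_filter]
    constructor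
    · intro hP
      have := (mem_primeDivisors (hD0 j (mem_Icc.1 hj).1)).1 hP
      exact ⟨mem_biUnion.2 ⟨j, hj, hP⟩, (dvd_mul_pow_sub_one_iff this.2.1 j).1 this.2.2⟩
    · rintro ⟨hP, h⟩
      exact (mem_primeDivisors (hD0 j (mem_Icc.1 hj).1)).2
        ⟨(hsi P hP).1, (hsi P hP).2, (dvd_mul_pow_sub_one_iff (hsi P hP).2 j).2 h⟩
  have hB : ∀ x, ∏ P ∈ s with 1 ≤ orderModulo g P ∧ orderModulo g P ≤ x, (1 + w P)
      ≤ totientRatio (orderPoly g x) := by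
    intro x
    rw [totientRatio, prod_congr rfl fun P _ => hw1 P]
    have h0 := orderPoly_ne_zero hg x
    refine prod_le_prod_of_subset_of_one_le ?_ ?_ ?_
    · intro P hP
      rw [mem_filter] at hP
      exact (mem_primeDivisors h0).2 ⟨(hsi P hP.1).1, (hsi P hP.1).2,
        dvd_orderPoly (hsi P hP.1).2 hP.2.1 hP.2.2⟩
    · intro P hP
      exact zero_le_one.trans (one_le_inv_one_sub (hsi P (mem_filter.1 hP).1).2)
    · intro P hP _
      exact one_le_inv_one_sub ((mem_primeDivisors h0).1 hP).2.1
  rw [sum_congr rfl fun j hj => by rw [hL j hj]]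
  refine (weighted_sum_prod_le s (orderModulo g) w hw0 hX).trans ?_
  gcongr with x
  · exact hB x
  · exact hB X

end Romanoff

/-! ### Numerical estimates for Abel means -/

section AbelSums

open Real

/-- `∑_{x ≥ 1} b x / (x (x + 1))` for the sequence `b` frozen from the index `X` on. -/
noncomputable def abelMean (b : ℕ → ℝ) (X : ℕ) : ℝ :=
  ∑ x ∈ Ico 1 X, b x / ((x : ℝ) * (x + 1)) + b X / X

lemma abelMean_one (b : ℕ → ℝ) : abelMean b 1 = b 1 := by simp [abelMean]

lemma abelMean_succ (b : ℕ → ℝ) {X : ℕ} (hX : 1 ≤ X) :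
    abelMean b (X + 1) = abelMean b X + (b (X + 1) - b X) / (X + 1) := by
  have hX0 : (0 : ℝ) < X := by exact_mod_cast hX
  rw [abelMean, abelMean, sum_Ico_succ_top hX]
  push_cast
  field_simp
  ring

/-- The weights `1 / (x (x + 1))` for `x < X` and `1 / X` are nonnegative with sum 1, so `abelMean`
is a genuine mean. -/
lemma abelMean_le_affine {b B : ℕ → ℝ} {V E : ℝ} {X : ℕ} (hX : 1 ≤ X)
    (hB : ∀ x, 1 ≤ x → B x ≤ V + E * b x) :
    abelMean B X ≤ V + E * abelMean b X := by
  have h1 := one_div_eq_sum_Ico le_rfl hX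
  have h2 : V + E * abelMean b X = abelMean (fun x => V + E * b x) X := by
    have h3 : V + E * abelMean b X
        = V * (∑ x ∈ Ico 1 X, 1 / ((x : ℝ) * (x + 1)) + 1 / X) + E * abelMean b X := by
      rw [← h1]; simp
    rw [h3, abelMean, abelMean]
    simp only [mul_add, mul_sum, add_div, sum_add_distrib, mul_div_assoc, mul_one_div]
    ring
  rw [h2, abelMean, abelMean]
  gcongr with x hx
  · exact hB x (mem_Icc.1 (Ico_subset_Icc_self hx)).1
  · exact hB X hX

/-- The increments are about `2 / X ^ 2`; the margin `2 / (X - 1 / 2)` telescopes to absorb them. -/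
lemma abelMean_log_quadratic_tail {X : ℕ} (hX : 4 ≤ X) :
    abelMean (fun x => log (2 + (x : ℝ) * (x - 1) / 2)) X ≤ log 6 - 2 / ((X : ℝ) - 1 / 2) := by
  induction X, hX using Nat.le_induction with
  | base =>
    rw [abelMean_succ _ (by norm_num), abelMean_succ _ (by norm_num), abelMean_succ _ (by norm_num),
      abelMean_one]
    norm_num
    have h1 : log 8 = 3 * log 2 := by
      rw [show (8 : ℝ) = 2 ^ 3 by norm_num, log_pow]; norm_num
    have h2 : log 6 = log 2 + log 3 := by
      rw [← log_mul (by norm_num) (by norm_num)]; norm_num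
    -- Cleared of denominators, the base case asks for `48 / 7 + log 40 ≤ 10 * log 3`. Rounding `48
    -- / 7` up to 7 leaves `40 * e ^ 7 ≤ 3 ^ 10`.
    have h3 : (7 : ℝ) + (3 * log 2 + log 5) ≤ 10 * log 3 := by
      have h4 : 3 * log 2 + log 5 = log 40 := by
        rw [← h1, ← log_mul (by norm_num) (by norm_num)]; norm_num
      have h5 : 10 * log 3 = log 59049 := by
        rw [show (59049 : ℝ) = 3 ^ 10 by norm_num, log_pow]; norm_num
      rw [h4, h5, ← le_sub_iff_add_le, ← log_div (by norm_num) (by norm_num),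
        le_log_iff_exp_le (by norm_num)]
      have h6 : exp 7 = exp 1 ^ 7 := by rw [← exp_nat_mul]; norm_num
      have h7 : exp 1 ^ 7 ≤ (2.7182818286 : ℝ) ^ 7 := by gcongr; exact exp_one_lt_d9.le
      rw [h6]
      refine h7.trans ?_
      norm_num
    rw [h1, h2]
    linarith
  | succ X hX ih =>
    have hX' : (4 : ℝ) ≤ X := by exact_mod_cast hX
    rw [abelMean_succ _ (by omega)]
    have ha : (0 : ℝ) < 2 + (X : ℝ) * (X - 1) / 2 := by nlinarith
    have h1 : log (2 + ((X + 1 : ℕ) : ℝ) * ((X + 1 : ℕ) - 1) / 2) - log (2 + (X : ℝ) * (X - 1) / 2)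
        ≤ X / (2 + (X : ℝ) * (X - 1) / 2) := by
      push_cast
      rw [← log_div (by nlinarith) ha.ne']
      refine (log_le_sub_one_of_pos (div_pos (by nlinarith) ha)).trans (le_of_eq ?_)
      rw [div_sub_one ha.ne']
      congr 1
      ring
    have h2 : (X / (2 + (X : ℝ) * (X - 1) / 2)) / ((X : ℝ) + 1)
        ≤ 2 / ((X : ℝ) - 1 / 2) - 2 / ((X : ℝ) + 1 - 1 / 2) := by
      have hb : (0 : ℝ) < X - 1 / 2 := by linarith
      have hc : (0 : ℝ) < X + 1 - 1 / 2 := by linarith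
      rw [div_sub_div _ _ hb.ne' hc.ne', div_div, div_le_div_iff₀ (by positivity) (by positivity)]
      nlinarith
    have h3 : (log (2 + ((X + 1 : ℕ) : ℝ) * ((X + 1 : ℕ) - 1) / 2) -
        log (2 + (X : ℝ) * (X - 1) / 2)) / ((X : ℝ) + 1)
        ≤ (X / (2 + (X : ℝ) * (X - 1) / 2)) / ((X : ℝ) + 1) := by gcongr
    push_cast at h3 ⊢
    linarith

lemma abelMean_log_quadratic_le {X : ℕ} (hX : 1 ≤ X) :
    abelMean (fun x => log (2 + (x : ℝ) * (x - 1) / 2)) X ≤ log 6 := by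
  have h26 : log 6 = log 2 + log 3 := by
    rw [← log_mul (by norm_num) (by norm_num)]; norm_num
  have h2 : 0 < log 2 := log_pos (by norm_num)
  have h3 : 0 < log 3 := log_pos (by norm_num)
  rcases le_or_gt 4 X with h | h
  · have := abelMean_log_quadratic_tail h
    have h4 : (4 : ℝ) ≤ X := by exact_mod_cast h
    have h5 : 0 ≤ 2 / ((X : ℝ) - 1 / 2) := div_nonneg (by norm_num) (by linarith)
    linarith
  · interval_cases X
    · rw [abelMean_one]
      norm_num
      linarith
    · rw [abelMean_succ _ (by norm_num), abelMean_one]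
      norm_num
      linarith
    · rw [abelMean_succ _ (by norm_num), abelMean_succ _ (by norm_num), abelMean_one]
      norm_num
      have h5 : log 5 ≤ log 6 := log_le_log (by norm_num) (by norm_num)
      linarith

lemma sqrt_div_telescope {x : ℕ} (hx : 1 ≤ x) :
    √(x : ℝ) / ((x : ℝ) * (x + 1)) ≤ 2 * (1 / √(x : ℝ) - 1 / √((x : ℝ) + 1)) := by
  have hx0 : (0 : ℝ) < x := by exact_mod_cast hx
  set a := √(x : ℝ) with ha
  set b := √((x : ℝ) + 1) with hb
  have ha0 : 0 < a := sqrt_pos.2 hx0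
  have hb0 : 0 < b := sqrt_pos.2 (by linarith)
  have ha2 : (x : ℝ) = a ^ 2 := (sq_sqrt hx0.le).symm
  have hb2 : (x : ℝ) + 1 = b ^ 2 := (sq_sqrt (by linarith)).symm
  have hab : b ^ 2 = a ^ 2 + 1 := by rw [← hb2, ha2]
  have hle : a ≤ b := sqrt_le_sqrt (by linarith)
  rw [hb2, ha2, div_sub_div _ _ ha0.ne' hb0.ne', mul_div_assoc', div_le_div_iff₀ (by positivity)
    (by positivity)]
  have h1 : 1 ≤ 2 * b * (b - a) := by nlinarith
  nlinarith [mul_pos (mul_pos ha0 ha0) hb0]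

/-- The range up to `y` contributes at most `(y + 1) / y ^ 2 ≤ (6 / 5) / y`, and the square-root
tail at most `(8 / 3) / y` by telescoping. The sum stays below `5 / y`. -/
lemma abelMean_le_five_div {y : ℝ} (hy : 5 ≤ y) {b : ℕ → ℝ}
    (h1 : ∀ x : ℕ, 1 ≤ x → (x : ℝ) ≤ y → b x ≤ (2 + (x : ℝ) * (x - 1) / 2) / y ^ 2)
    (h2 : ∀ x : ℕ, y < x → b x ≤ 4 / 3 * √((x : ℝ) / y)) {X : ℕ} (hX : 1 ≤ X) :
    abelMean b X ≤ 5 / y := by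
  have hy0 : 0 < y := by linarith
  have hsmall : ∀ X : ℕ, 1 ≤ X →
      abelMean (fun x => (2 + (x : ℝ) * (x - 1) / 2) / y ^ 2) X ≤ ((X : ℝ) + 1) / y ^ 2 := by
    intro X hX
    induction X, hX using Nat.le_induction with
    | base => rw [abelMean_one]; norm_num
    | succ X hX ih =>
      rw [abelMean_succ _ hX]
      have : ((2 + ((X + 1 : ℕ) : ℝ) * ((X + 1 : ℕ) - 1) / 2) / y ^ 2 -
          (2 + (X : ℝ) * (X - 1) / 2) / y ^ 2) / ((X : ℝ) + 1) ≤ 1 / y ^ 2 := by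
        rw [← sub_div, div_div, div_le_div_iff₀ (by positivity) (by positivity)]
        push_cast
        nlinarith [sq_nonneg y]
      push_cast at this ⊢
      rw [add_div _ (1 : ℝ)]
      linarith
  have hsum : ∀ X : ℕ, 1 ≤ X → (X : ℝ) ≤ y → abelMean b X ≤ 6 / 5 / y := by
    intro X hX hXy
    have h3 : abelMean b X ≤ abelMean (fun x => (2 + (x : ℝ) * (x - 1) / 2) / y ^ 2) X := by
      rw [abelMean, abelMean]
      gcongr with x hx
      · rw [mem_Ico] at hx
        exact h1 x hx.1 (le_trans (by exact_mod_cast hx.2.le) hXy)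
      · exact h1 X hX hXy
    refine h3.trans ((hsmall X hX).trans ?_)
    rw [div_le_div_iff₀ (by positivity) hy0]
    nlinarith
  have hb0 : ∀ x : ℕ, 1 ≤ x → 0 ≤ (2 + (x : ℝ) * (x - 1) / 2) / y ^ 2 := by
    intro x hx
    have : (1 : ℝ) ≤ x := by exact_mod_cast hx
    exact div_nonneg (by nlinarith) (by positivity)
  set X₀ := ⌊y⌋₊ with hX₀
  have hX₀1 : 1 ≤ X₀ := Nat.le_floor (by push_cast; linarith)
  have hX₀y : (X₀ : ℝ) ≤ y := Nat.floor_le hy0.le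
  have hsqrt : ∀ x : ℕ, √((x : ℝ) / y) = √(x : ℝ) / √y := fun x => sqrt_div (Nat.cast_nonneg x) y
  have hsy : 0 < √y := sqrt_pos.2 hy0
  have hyy : √y * √y = y := mul_self_sqrt hy0.le
  have htail : ∀ X : ℕ, X₀ + 1 ≤ X → ∑ x ∈ Ico 1 X, b x / ((x : ℝ) * (x + 1))
      ≤ 6 / 5 / y + 8 / 3 * (1 / y - 1 / √y * (1 / √(X : ℝ))) := by
    intro X hX
    induction X, hX using Nat.le_induction with
    | base =>
      have h4 : ∑ x ∈ Ico 1 (X₀ + 1), b x / ((x : ℝ) * (x + 1)) ≤ 6 / 5 / y := by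
        have h5 : ∑ x ∈ Ico 1 (X₀ + 1), b x / ((x : ℝ) * (x + 1))
            ≤ abelMean (fun x => (2 + (x : ℝ) * (x - 1) / 2) / y ^ 2) X₀ := by
          rw [sum_Ico_succ_top hX₀1, abelMean]
          refine add_le_add (sum_le_sum fun x hx => ?_) ?_
          · rw [mem_Ico] at hx
            have := h1 x hx.1 (le_trans (by exact_mod_cast hx.2.le) hX₀y)
            gcongr
          · have h6 : (1 : ℝ) ≤ X₀ := by exact_mod_cast hX₀1
            have h7 := hb0 X₀ hX₀1
            calc b X₀ / ((X₀ : ℝ) * (X₀ + 1))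
                ≤ (2 + (X₀ : ℝ) * (X₀ - 1) / 2) / y ^ 2 / ((X₀ : ℝ) * (X₀ + 1)) := by
                  gcongr; exact h1 X₀ hX₀1 hX₀y
              _ ≤ _ := by
                  gcongr
                  nlinarith
        refine h5.trans ((hsmall X₀ hX₀1).trans ?_)
        rw [div_le_div_iff₀ (by positivity) hy0]
        nlinarith
      have h8 : y ≤ ((X₀ + 1 : ℕ) : ℝ) := by
        push_cast; exact (Nat.lt_floor_add_one y).le
      have h9 : 1 / √y * (1 / √((X₀ + 1 : ℕ) : ℝ)) ≤ 1 / y := by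
        calc 1 / √y * (1 / √((X₀ + 1 : ℕ) : ℝ)) ≤ 1 / √y * (1 / √y) := by gcongr
          _ = 1 / y := by rw [one_div_mul_one_div, hyy]
      linarith
    | succ X hX ih =>
      have hXy : y < X := (Nat.lt_floor_add_one y).trans_le (by exact_mod_cast hX)
      have hX1 : 1 ≤ X := by omega
      rw [sum_Ico_succ_top hX1]
      have h4 : b X / ((X : ℝ) * (X + 1))
          ≤ 8 / 3 * (1 / √y * (1 / √(X : ℝ)) - 1 / √y * (1 / √((X : ℝ) + 1))) := by
        calc b X / ((X : ℝ) * (X + 1)) ≤ 4 / 3 * (√(X : ℝ) / √y) / ((X : ℝ) * (X + 1)) := by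
              gcongr; rw [← hsqrt]; exact h2 X hXy
          _ = 4 / 3 * (1 / √y) * (√(X : ℝ) / ((X : ℝ) * (X + 1))) := by ring
          _ ≤ 4 / 3 * (1 / √y) * (2 * (1 / √(X : ℝ) - 1 / √((X : ℝ) + 1))) := by
              gcongr; exact sqrt_div_telescope hX1
          _ = _ := by ring
      push_cast
      linarith
  rcases le_or_gt (X : ℝ) y with hXy | hXy
  · refine (hsum X hX hXy).trans ?_
    gcongr
    norm_num
  · have hXX : X₀ + 1 ≤ X := by
      rw [Nat.succ_le_iff, hX₀, Nat.floor_lt hy0.le]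
      exact hXy
    have h3 := htail X hXX
    have hX0 : (0 : ℝ) < X := by linarith
    have h4 : b X / X ≤ 4 / 3 * (1 / √y * (1 / √(X : ℝ))) := by
      calc b X / X ≤ 4 / 3 * (√(X : ℝ) / √y) / X := by
            gcongr; rw [← hsqrt]; exact h2 X hXy
        _ = 4 / 3 * (1 / √y) * (√(X : ℝ) / X) := by ring
        _ = _ := by rw [sqrt_div_self]; ring
    have h5 : 0 ≤ 1 / √y * (1 / √(X : ℝ)) := by positivity
    have h6 : 6 / 5 / y + 8 / 3 * (1 / y) ≤ 5 / y := by
      rw [← sub_nonneg]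
      have : 5 / y - (6 / 5 / y + 8 / 3 * (1 / y)) = 17 / 15 / y := by field_simp; norm_num
      rw [this]; positivity
    rw [abelMean]
    linarith

/-- Write `log t` as four times the logarithm of the fourth root and use `log s ≤ s - 1`. -/
lemma one_add_log_div_le {t l : ℝ} (ht : 1 ≤ t) (hl : 3 ≤ l) :
    1 + log t / l ≤ 4 / 3 * √(√t) := by
  have h1 : log t = 4 * log (√(√t)) := by
    rw [log_sqrt (by positivity), log_sqrt (by linarith)]; ring
  have h2 : log (√(√t)) ≤ √(√t) - 1 := log_le_sub_one_of_pos (by positivity)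
  have h3 : log t / l ≤ log t / 3 := div_le_div_of_nonneg_left (log_nonneg ht) (by norm_num) hl
  linarith

/-- In this range the minimum in the theorem is its logarithmic term, so the square-root bound is
needed only for `q ≥ 25 * δ`. -/
lemma log_six_mul_div_log_le {δ q : ℝ} (hδ : 1 ≤ δ) (hq : 2 ≤ q) (h : q ≤ 25 * δ) :
    log (6 * δ) / log q ≤ 5 * √(δ / q) := by
  have hlq : 0 < log q := log_pos (by linarith)
  have hl2 := log_two_gt_d9
  have hl2' := log_two_lt_d9
  have hlq2 : log 2 ≤ log q := log_le_log (by norm_num) hq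
  set u := √(δ / q) with hu
  have hu0 : 0 < u := sqrt_pos.2 (by positivity)
  have hu2 : u ^ 2 = δ / q := sq_sqrt (by positivity)
  have hu1 : 1 ≤ 5 * u := by
    have : (1 / 5 : ℝ) ^ 2 ≤ u ^ 2 := by
      rw [hu2, le_div_iff₀ (by linarith)]; linarith
    have := abs_le_of_sq_le_sq' this hu0.le
    linarith [this.2]
  have h6 : log (6 * δ) = log q + log (6 * u ^ 2) := by
    rw [← log_mul (by linarith) (by positivity), hu2]
    congr 1
    field_simp
  rw [h6, add_div, div_self hlq.ne']
  rcases le_or_gt (6 * u ^ 2) 1 with hle | hlt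
  · have : log (6 * u ^ 2) / log q ≤ 0 :=
      div_nonpos_of_nonpos_of_nonneg (log_nonpos (by positivity) hle) hlq.le
    linarith
  -- Prepares the tangent-line bound at `√6 * u = 2`; the constant 0.6136 is just below `2 - 2 * log
  -- 2`.
  · have h7 : log (6 * u ^ 2) = 2 * log 2 + 2 * log (√6 * u / 2) := by
      rw [show 6 * u ^ 2 = 2 ^ 2 * (√6 * u / 2) ^ 2 by
        rw [div_pow, mul_pow, sq_sqrt (show (0 : ℝ) ≤ 6 by norm_num)]; ring, log_mul (by norm_num) (by positivity),
        log_pow, log_pow]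
      push_cast
      ring
    have h8 : log (√6 * u / 2) ≤ √6 * u / 2 - 1 := log_le_sub_one_of_pos (by positivity)
    have h9 : √6 ≤ 2.45 := by
      rw [sqrt_le_left (by norm_num)]; norm_num
    have h10 : log (6 * u ^ 2) ≤ 2.45 * u - 0.6136 := by nlinarith
    have h11 : log (6 * u ^ 2) / log q ≤ log (6 * u ^ 2) / log 2 :=
      div_le_div_of_nonneg_left (log_nonneg hlt.le) (by linarith) hlq2
    have h12 : log (6 * u ^ 2) / log 2 ≤ 5 * u - 1 := by
      rw [div_le_iff₀ (by linarith)]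
      have hu3 : 0.4 ≤ u := by nlinarith
      nlinarith
    linarith

end AbelSums

/-! ### The mean of the singular series -/

section SingularSeries

open Real

variable {F : Type*} [Field F] [Fintype F]

/-- The Mertens bound alone gives the logarithmic term. For `25 * δ ≤ q` it is replaced, as long as
the degree is at most `q`, by the bound linear in the degree, and `abelMean_le_five_div` applies
with `y = √(q / δ)`. -/
theorem abelMean_totientRatio_le {g : F[X]} (hg : 1 ≤ g.natDegree) {X : ℕ} (hX : 1 ≤ X) :
    abelMean (fun x => totientRatio (orderPoly g x)) X
      ≤ (Fintype.card F : ℝ) / ((Fintype.card F : ℝ) - 1) *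
        (1 + exp eulerMascheroniConstant * min (5 * √((g.natDegree : ℝ) / Fintype.card F))
          (log (6 * g.natDegree) / log (Fintype.card F))) := by
  have hq := two_le_card (F := F)
  have hδ : (1 : ℝ) ≤ g.natDegree := by exact_mod_cast hg
  set δ : ℝ := (g.natDegree : ℝ) with hδdef
  set q : ℝ := (Fintype.card F : ℝ) with hqdef
  have hlq : 0 < log q := log_pos (by linarith)
  have hc1 : ∀ x : ℕ, 1 ≤ x → 1 ≤ 2 + (x : ℝ) * (x - 1) / 2 := by
    intro x hx
    have : (1 : ℝ) ≤ x := by exact_mod_cast hx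
    nlinarith
  have hdeg : ∀ x, ((orderPoly g x).natDegree : ℝ) = δ * (2 + (x : ℝ) * (x - 1) / 2) :=
    natDegree_orderPoly hg
  have hdeg1 : ∀ x, 1 ≤ x → 1 ≤ (orderPoly g x).natDegree := by
    intro x hx
    have : (1 : ℝ) ≤ (orderPoly g x).natDegree := by
      rw [hdeg]; nlinarith [hc1 x hx]
    exact_mod_cast this
  have hmert : ∀ x, 1 ≤ x → totientRatio (orderPoly g x)
      ≤ q / (q - 1) * (1 + exp eulerMascheroniConstant *
        (log (δ * (2 + (x : ℝ) * (x - 1) / 2)) / log q)) := by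
    intro x hx
    have := totientRatio_le (hdeg1 x hx)
    rwa [hdeg] at this
  have hV : 0 ≤ q / (q - 1) := div_nonneg (by linarith) (by linarith)
  have hE : 0 ≤ q / (q - 1) * exp eulerMascheroniConstant := mul_nonneg hV (exp_pos _).le
  have hlog : abelMean (fun x => totientRatio (orderPoly g x)) X ≤ q / (q - 1) *
        (1 + exp eulerMascheroniConstant * (log (6 * δ) / log q)) := by
    refine (abelMean_le_affine (V := q / (q - 1)) (E := q / (q - 1) * exp eulerMascheroniConstant)
      (b := fun x => log (δ * (2 + (x : ℝ) * (x - 1) / 2)) / log q) hX fun x hx =>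
        (hmert x hx).trans (le_of_eq (by ring))).trans ?_
    rw [mul_add, mul_one, ← mul_assoc]
    gcongr
    refine (abelMean_le_affine (V := log δ / log q) (E := 1 / log q)
      (b := fun x => log (2 + (x : ℝ) * (x - 1) / 2)) hX fun x hx => ?_).trans ?_
    · rw [log_mul (by linarith) (by linarith [hc1 x hx])]
      exact le_of_eq (by ring)
    · rw [log_mul (by norm_num) (by linarith), add_comm (log 6), add_div, div_eq_mul_one_div (log 6),
        mul_comm (log 6)]
      gcongr
      exact abelMean_log_quadratic_le hX
  have hsqrt : 25 * δ ≤ q → abelMean (fun x => totientRatio (orderPoly g x)) X ≤ q / (q - 1) *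
        (1 + exp eulerMascheroniConstant * (5 * √(δ / q))) := by
    intro h25
    set y := √(q / δ) with hy
    have hyq : y ^ 2 = q / δ := sq_sqrt (by positivity)
    have hy5 : 5 ≤ y := by
      rw [hy, le_sqrt (by norm_num) (by positivity), le_div_iff₀ (by linarith)]
      linarith
    have hyinv : 5 / y = 5 * √(δ / q) := by
      rw [hy, div_eq_mul_inv, ← sqrt_inv, inv_div]
    have ht : ∀ c : ℝ, δ * c / q = c / y ^ 2 := by
      intro c; rw [hyq]; field_simp
    -- Here `q ≥ 25 > e ^ 3`.
    have hl3 : 3 ≤ log q := by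
      rw [le_log_iff_exp_le (by linarith)]
      have h6 : exp 3 = exp 1 ^ 3 := by rw [← exp_nat_mul]; norm_num
      have h7 : exp 1 ^ 3 ≤ (2.7182818286 : ℝ) ^ 3 := by gcongr; exact exp_one_lt_d9.le
      rw [h6]
      refine h7.trans (le_trans ?_ h25)
      norm_num
      linarith
    set b : ℕ → ℝ := fun x => if δ * (2 + (x : ℝ) * (x - 1) / 2) ≤ q then
      δ * (2 + (x : ℝ) * (x - 1) / 2) / q else log (δ * (2 + (x : ℝ) * (x - 1) / 2)) / log q with hb
    refine (abelMean_le_affine (V := q / (q - 1)) (E := q / (q - 1) * exp eulerMascheroniConstant)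
      (b := b) hX fun x hx => ?_).trans ?_
    · rw [mul_assoc, ← mul_one_add]
      simp only [hb]
      split_ifs with hxq
      · rw [← hdeg] at hxq ⊢
        exact totientRatio_le_of_natDegree_le (orderPoly_ne_zero hg x) (by
          rw [hqdef] at hxq; exact_mod_cast hxq)
      · exact hmert x hx
    · rw [mul_add, mul_one, ← mul_assoc]
      gcongr
      rw [← hyinv]
      refine abelMean_le_five_div hy5 ?_ ?_ hX
      · intro x hx hxy
        have hxq : δ * (2 + (x : ℝ) * (x - 1) / 2) ≤ q := by
          rw [← div_le_one (by linarith), ht, div_le_one (by positivity)]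
          rcases hx.eq_or_lt with rfl | hx2
          · norm_num; nlinarith
          · have : (2 : ℝ) ≤ x := by exact_mod_cast hx2
            nlinarith
        simp only [hb, if_pos hxq, ht]
        exact le_rfl
      · intro x hxy
        have hxy1 : 1 ≤ (x : ℝ) / y := by rw [le_div_iff₀ (by linarith)]; linarith
        simp only [hb]
        split_ifs with hxq
        · have h1 : δ * (2 + (x : ℝ) * (x - 1) / 2) / q ≤ 1 := (div_le_one (by linarith)).2 hxq
          have h2 : 1 ≤ √((x : ℝ) / y) := one_le_sqrt.2 hxy1
          linarith
        · push Not at hxq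
          have h1 : 1 ≤ δ * (2 + (x : ℝ) * (x - 1) / 2) / q :=
            (one_le_div (by linarith)).2 hxq.le
          have h2 : log (δ * (2 + (x : ℝ) * (x - 1) / 2)) / log q
              = 1 + log (δ * (2 + (x : ℝ) * (x - 1) / 2) / q) / log q := by
            rw [log_div (by linarith) (by linarith), sub_div, div_self hlq.ne']
            ring
          rw [h2]
          -- The ratio of the degree to `q` is at most `(x / y) ^ 2`, so its fourth root is at most
          -- `√(x / y)`.
          refine (one_add_log_div_le h1 hl3).trans ?_
          gcongr
          rw [ht, sqrt_le_left (by linarith), div_pow]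
          gcongr
          nlinarith
  rcases le_or_gt (25 * δ) q with h25 | h25
  · rcases min_choice (5 * √(δ / q)) (log (6 * δ) / log q) with h | h
    · rw [h]; exact hsqrt h25
    · rw [h]; exact hlog
  · rwa [min_eq_right (log_six_mul_div_log_le hδ (by linarith) h25.le)]

end SingularSeries

/-! ### Sieving pairs of irreducibles -/

section TwinPrimes

variable {F : Type*} [Field F] [Fintype F]

open scoped Classical in
/-- Irreducible polynomials of degree `n`, not necessarily monic. -/
noncomputable def irreduciblesOfDegree (F : Type*) [Field F] [Fintype F] (n : ℕ) : Finset F[X] :=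
  {h ∈ ltDegree F (n + 1) | Irreducible h ∧ h.natDegree = n}

lemma mem_irreduciblesOfDegree {n : ℕ} {h : F[X]} :
    h ∈ irreduciblesOfDegree F n ↔ Irreducible h ∧ h.natDegree = n := by
  simp only [irreduciblesOfDegree, mem_filter, mem_ltDegree, and_iff_right_iff_imp]
  rintro ⟨h1, rfl⟩
  rw [degree_eq_natDegree h1.ne_zero]
  exact_mod_cast Nat.lt_succ_self _

lemma card_irreduciblesOfDegree (n : ℕ) : ((irreduciblesOfDegree F n).card : ℝ)
    = ((Fintype.card F : ℝ) - 1) * (primesOfDegree F n).card := by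
  classical
  have h1 : (irreduciblesOfDegree F n).card
      = (((univ : Finset F).erase 0) ×ˢ primesOfDegree F n).card := by
    refine card_nbij' (fun h => (h.leadingCoeff, C h.leadingCoeff⁻¹ * h)) (fun p => C p.1 * p.2)
      ?_ ?_ ?_ ?_
    · intro h hh
      rw [mem_coe, mem_irreduciblesOfDegree] at hh
      have hl : h.leadingCoeff ≠ 0 := leadingCoeff_ne_zero.2 hh.1.ne_zero
      simp only [coe_product, Set.mem_prod, mem_coe, mem_erase, mem_univ, and_true,
        mem_primesOfDegree]
      refine ⟨hl, monic_C_mul_of_mul_leadingCoeff_eq_one (inv_mul_cancel₀ hl), ?_, ?_⟩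
      · rw [natDegree_C_mul (inv_ne_zero hl), hh.2]
      · exact (irreducible_isUnit_mul (isUnit_C.2 (inv_ne_zero hl).isUnit)).2 hh.1
    · intro p hp
      simp only [coe_product, Set.mem_prod, mem_coe, mem_erase, mem_univ, and_true,
        mem_primesOfDegree] at hp
      rw [mem_coe, mem_irreduciblesOfDegree, natDegree_C_mul hp.1]
      exact ⟨(irreducible_isUnit_mul (isUnit_C.2 hp.1.isUnit)).2 hp.2.2.2, hp.2.2.1⟩
    · intro h hh
      rw [mem_coe, mem_irreduciblesOfDegree] at hh
      have hl : h.leadingCoeff ≠ 0 := leadingCoeff_ne_zero.2 hh.1.ne_zero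
      simp only
      rw [← mul_assoc, ← C_mul, mul_inv_cancel₀ hl, C_1, one_mul]
    · intro p hp
      simp only [coe_product, Set.mem_prod, mem_coe, mem_erase, mem_univ, and_true,
        mem_primesOfDegree] at hp
      have hl : (C p.1 * p.2).leadingCoeff = p.1 := by
        rw [leadingCoeff_mul, leadingCoeff_C, hp.2.1.leadingCoeff, mul_one]
      refine Prod.ext hl ?_
      simp only [hl]
      rw [← mul_assoc, ← C_mul, inv_mul_cancel₀ hp.1, C_1, one_mul]
  rw [h1, card_product, card_erase_of_mem (mem_univ _), card_univ, Nat.cast_mul,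
    Nat.cast_sub Fintype.card_pos, Nat.cast_one]

lemma dvd_sub_iff_eq_modByMonic {P a b : F[X]} (hP : P.Monic) (ha : a ∈ ltDegree F P.natDegree) :
    P ∣ a - b ↔ a = b %ₘ P := by
  rw [mem_ltDegree, ← degree_eq_natDegree hP.ne_zero] at ha
  rw [← modByMonic_eq_zero_iff_dvd hP, sub_modByMonic, (modByMonic_eq_self_iff hP).2 ha, sub_eq_zero]

-- The forbidden classes are those of `-s` and `-s - D`, which coincide exactly when `P ∣ D`.
open scoped Classical in
lemma card_forbidden_residues {P : F[X]} (hP : P.Monic) (hPi : Irreducible P) (s D : F[X]) :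
    ((ltDegree F P.natDegree).filter fun a => P ∣ (s + a) * (s + a + D)).card
      = if P ∣ D then 1 else 2 := by
  have hmod : ∀ b : F[X], b %ₘ P ∈ ltDegree F P.natDegree := by
    intro b
    rw [mem_ltDegree, ← degree_eq_natDegree hP.ne_zero]
    exact degree_modByMonic_lt b hP
  have h1 : ((ltDegree F P.natDegree).filter fun a => P ∣ (s + a) * (s + a + D))
      = {(-s) %ₘ P, (-s - D) %ₘ P} := by
    ext a
    rw [mem_filter, mem_insert, mem_singleton]
    have key : a ∈ ltDegree F P.natDegree →
        (P ∣ (s + a) * (s + a + D) ↔ a = (-s) %ₘ P ∨ a = (-s - D) %ₘ P) := by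
      intro ha
      rw [hPi.prime.dvd_mul, ← dvd_sub_iff_eq_modByMonic hP ha, ← dvd_sub_iff_eq_modByMonic hP ha,
        show s + a = a - -s by ring, show a - -s + D = a - (-s - D) by ring]
    constructor
    · rintro ⟨h, h'⟩
      exact (key h).1 h'
    · intro h
      have ha : a ∈ ltDegree F P.natDegree := by
        rcases h with rfl | rfl <;> exact hmod _
      exact ⟨ha, (key ha).2 h⟩
  have h2 : (-s) %ₘ P = (-s - D) %ₘ P ↔ P ∣ D := by
    rw [← dvd_sub_iff_eq_modByMonic hP (hmod _), ← modByMonic_eq_zero_iff_dvd hP,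
      ← modByMonic_eq_zero_iff_dvd hP, sub_modByMonic, sub_modByMonic,
      (modByMonic_eq_self_iff hP).2 (degree_modByMonic_lt _ hP), sub_sub_cancel]
  rw [h1]
  split_ifs with h
  · rw [h2.2 h, pair_eq_singleton, card_singleton]
  · rw [card_pair (fun h' => h (h2.1 h'))]

lemma not_dvd_of_irreducible_of_natDegree_lt {K : Type*} [Field K] {P h : K[X]}
    (hP : Irreducible P) (hh : Irreducible h) (hlt : P.natDegree < h.natDegree) : ¬ P ∣ h := by
  intro hd
  exact hlt.ne (natDegree_eq_of_degree_eq (degree_eq_degree_of_associated (hP.associated_of_dvd hh hd)))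

-- Subtracting the fixed leading term `c X ^ n` moves the set into degree less than `n`. Primes of
-- degree at most `m = n / 2 < n` divide neither `h` nor `h + D`, so the large sieve applies.
open scoped Classical in
lemma card_twins_leadingCoeff_le {n : ℕ} (hn : 1 ≤ n) {D : F[X]} (hD : D ≠ 0) (c : F) :
    ((((irreduciblesOfDegree F n).filter fun h => h + D ∈ irreduciblesOfDegree F n).filter
      fun h => h.leadingCoeff = c).card : ℝ) * ((n : ℝ) ^ 2 / 8)
      ≤ (Fintype.card F : ℝ) ^ n * totientRatio D := by
  set m := n / 2 with hm
  set s : F[X] := C c * X ^ n with hs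
  set T := ((irreduciblesOfDegree F n).filter fun h => h + D ∈ irreduciblesOfDegree F n).filter
      fun h => h.leadingCoeff = c with hT
  have hTmem : ∀ h ∈ T, Irreducible h ∧ h.natDegree = n ∧ Irreducible (h + D) ∧
      (h + D).natDegree = n ∧ h.leadingCoeff = c := by
    intro h hh
    simp only [hT, mem_filter, mem_irreduciblesOfDegree] at hh
    tauto
  have hprime : ∀ P ∈ primesLE F m, P.Monic ∧ Irreducible P := fun P hP =>
    ⟨(mem_primesLE.1 hP).1, (mem_primesLE.1 hP).2.1⟩
  have hbadT : ∀ h ∈ T, ∀ P ∈ primesLE F m, ¬ P ∣ h * (h + D) := by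
    intro h hh P hP
    obtain ⟨h1, h2, h3, h4, -⟩ := hTmem h hh
    obtain ⟨-, hPi, hPd⟩ := mem_primesLE.1 hP
    rw [hPi.prime.dvd_mul]
    rintro (h5 | h5)
    · exact not_dvd_of_irreducible_of_natDegree_lt hPi h1 (by omega) h5
    · exact not_dvd_of_irreducible_of_natDegree_lt hPi h3 (by omega) h5
  have hR := one_le_totientRatio D hD
  by_cases hω : ∀ P ∈ primesLE F m, (if P ∣ D then 1 else 2) < Fintype.card F ^ P.natDegree
  · set S := T.image fun h => h - s with hSdef
    have hcard : S.card = T.card := card_image_of_injective _ (sub_left_injective)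
    have hS : S ⊆ ltDegree F n := by
      intro r hr
      obtain ⟨h, hh, rfl⟩ := mem_image.1 hr
      obtain ⟨h1, h2, -, -, h5⟩ := hTmem h hh
      have h0 := h1.ne_zero
      have hs' : s = C h.leadingCoeff * X ^ h.natDegree := by rw [hs, h5, h2]
      rw [mem_ltDegree, hs', ← h2, ← degree_eq_natDegree h0]
      have hl : h.leadingCoeff ≠ 0 := leadingCoeff_ne_zero.2 h0
      refine degree_sub_lt_left ?_ h0 ?_
      · rw [degree_C_mul_X_pow _ hl, degree_eq_natDegree h0]
      · rw [leadingCoeff_C_mul_X_pow]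
    have hper : ∀ P ∈ primesLE F m, ∀ r t : F[X], P ∣ r - t →
        (P ∣ (s + r) * (s + r + D) ↔ P ∣ (s + t) * (s + t + D)) := by
      intro P _ r t hrt
      have : (s + r) * (s + r + D) = (s + t) * (s + t + D) +
          (r - t) * ((s + r + D) + (s + t)) := by ring
      rw [this]
      exact dvd_add_left (hrt.mul_right _)
    have hsieve := large_sieve (n := n) (m := m) (by omega) (primesLE F m) hprime
      (fun P r => P ∣ (s + r) * (s + r + D)) hper (fun P => if P ∣ D then 1 else 2)
      (fun P hP => by
        convert card_forbidden_residues (hprime P hP).1 (hprime P hP).2 s D) hω S hS (by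
        intro r hr P hP
        obtain ⟨h, hh, rfl⟩ := mem_image.1 hr
        simp only [add_sub_cancel]
        exact hbadT h hh P hP)
    have hdens := le_totientRatio_mul_sieve_sum hD m hω
    rw [hcard] at hsieve
    -- From `n ≤ 2 * m + 1`; this is the origin of the constant 8.
    have hmn : (n : ℝ) ^ 2 / 8 ≤ ((m : ℝ) + 1) * (m + 2) / 2 := by
      have : (n : ℝ) ≤ 2 * m + 1 := by exact_mod_cast (by omega : n ≤ 2 * m + 1)
      nlinarith [Nat.cast_nonneg (α := ℝ) n, Nat.cast_nonneg (α := ℝ) m]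
    refine (mul_le_mul_of_nonneg_left (hmn.trans hdens) (Nat.cast_nonneg _)).trans ?_
    rw [mul_left_comm, mul_comm]
    exact mul_le_mul_of_nonneg_right hsieve (by linarith)
  -- Some prime has all its residue classes forbidden, as can happen for linear primes over the
  -- field of two elements. Then there are no twins.
  · have hTe : T = ∅ := by
      rw [eq_empty_iff_forall_notMem]
      intro h hh
      push Not at hω
      obtain ⟨P, hP, hPω⟩ := hω
      rw [← card_forbidden_residues (hprime P hP).1 (hprime P hP).2 0 D, ← card_ltDegree] at hPω
      have hall := eq_of_subset_of_card_le (filter_subset _ _) hPω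
      have hmem : h %ₘ P ∈ ltDegree F P.natDegree := by
        rw [mem_ltDegree, ← degree_eq_natDegree (hprime P hP).1.ne_zero]
        exact degree_modByMonic_lt h (hprime P hP).1
      rw [← hall, mem_filter, zero_add] at hmem
      refine hbadT h hh P hP ?_
      have h1 : P ∣ h - h %ₘ P := ⟨h /ₘ P, by
        rw [sub_eq_iff_eq_add, add_comm]; exact (modByMonic_add_div h P).symm⟩
      have h2 : h * (h + D) = (h %ₘ P) * (h %ₘ P + D) + (h - h %ₘ P) * (h + D + h %ₘ P) := by ring
      rw [h2]
      exact dvd_add hmem.2 (h1.mul_right _)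
    rw [hTe, card_empty, Nat.cast_zero, zero_mul]
    exact mul_nonneg (by positivity) (by linarith)

open scoped Classical in
/-- Brun–Selberg upper bound for the number of irreducible `h` of degree `n` with `h + D`
irreducible of degree `n`. -/
theorem card_twins_le {n : ℕ} (hn : 1 ≤ n) {D : F[X]} (hD : D ≠ 0) :
    (((irreduciblesOfDegree F n).filter fun h => h + D ∈ irreduciblesOfDegree F n).card : ℝ)
      * ((n : ℝ) ^ 2 / 8)
      ≤ ((Fintype.card F : ℝ) - 1) * (Fintype.card F : ℝ) ^ n * totientRatio D := by
  rw [card_eq_sum_card_fiberwise (f := leadingCoeff) (t := (univ : Finset F).erase 0), Nat.cast_sum,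
    sum_mul]
  · refine (sum_le_sum fun c _ => card_twins_leadingCoeff_le hn hD c).trans (le_of_eq ?_)
    rw [sum_const, card_erase_of_mem (mem_univ _), card_univ, nsmul_eq_mul,
      Nat.cast_sub Fintype.card_pos, Nat.cast_one, mul_assoc]
  · intro h hh
    rw [mem_coe, mem_filter, mem_irreduciblesOfDegree] at hh
    rw [mem_coe, mem_erase]
    exact ⟨leadingCoeff_ne_zero.2 hh.1.1.ne_zero, mem_univ _⟩

end TwinPrimes

/-! ### Cauchy–Schwarz and the count of coincidences -/

section Collisions

/-- Cauchy–Schwarz: a lower bound for the size of the range of a map by counting collisions. -/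
lemma sq_card_le_card_mul_collisions {α β : Type*} [DecidableEq β] (A : Finset α) (R : Finset β)
    (φ : α → β) (hφ : ∀ a ∈ A, φ a ∈ R) :
    (A.card : ℝ) ^ 2 ≤ R.card * ∑ a ∈ A, ∑ b ∈ A, if φ a = φ b then (1 : ℝ) else 0 := by
  have h1 : (A.card : ℝ) = ∑ f ∈ R, ∑ a ∈ A, if φ a = f then (1 : ℝ) else 0 := by
    rw [sum_comm, sum_congr rfl fun a ha => by rw [sum_ite_eq, if_pos (hφ a ha)]]
    simp
  have h2 : ∑ a ∈ A, ∑ b ∈ A, (if φ a = φ b then (1 : ℝ) else 0)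
      = ∑ f ∈ R, (∑ a ∈ A, if φ a = f then (1 : ℝ) else 0) ^ 2 := by
    simp_rw [sq, sum_mul_sum]
    rw [sum_comm' (t' := A) (s' := fun _ => R) (by tauto)]
    refine sum_congr rfl fun a ha => ?_
    rw [sum_comm]
    refine sum_congr rfl fun b _ => ?_
    simp_rw [ite_mul, one_mul, zero_mul]
    rw [sum_ite_eq, if_pos (hφ a ha)]
    simp [eq_comm]
  rw [h2, h1]
  exact sq_sum_le_card_mul_sum_sq

/-- There are `2 * (X + 1 - j)` ordered pairs at distance `j`. With truncated subtraction `k - l +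
(l - k)` is `|k - l|`. -/
lemma sum_sum_range_distance (T : ℕ → ℝ) (X : ℕ) :
    ∑ k ∈ range (X + 1), ∑ l ∈ range (X + 1), (if k = l then 0 else T (k - l + (l - k)))
      = 2 * ∑ j ∈ Icc 1 X, ((X : ℝ) + 1 - j) * T j := by
  induction X with
  | zero => simp
  | succ X ih =>
    have hrow : ∑ l ∈ range (X + 1), (if X + 1 = l then 0 else T (X + 1 - l + (l - (X + 1))))
        = ∑ j ∈ Icc 1 (X + 1), T j := by
      rw [← sum_range_reflect, range_eq_Ico, sum_Ico_eq_sum_range]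
      rw [show Icc 1 (X + 1) = Ico 1 (X + 2) from rfl, sum_Ico_eq_sum_range]
      refine sum_congr rfl fun j hj => ?_
      rw [mem_range] at hj
      rw [if_neg (by omega)]
      congr 1
      omega
    have hcol : ∑ k ∈ range (X + 1), (if k = X + 1 then 0 else T (k - (X + 1) + (X + 1 - k)))
        = ∑ j ∈ Icc 1 (X + 1), T j := by
      rw [← hrow]
      refine sum_congr rfl fun k _ => ?_
      simp only [eq_comm, add_comm]
    rw [sum_range_succ, sum_congr rfl fun k _ => sum_range_succ _ (X + 1), sum_add_distrib, ih, hcol,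
      sum_range_succ, hrow, if_pos rfl, ← Finset.insert_Icc_right_eq_Icc_add_one (by omega),
      sum_insert (by simp), sum_insert (by simp)]
    have : ∑ j ∈ Icc 1 X, (((X + 1 : ℕ) : ℝ) + 1 - j) * T j
        = ∑ j ∈ Icc 1 X, ((X : ℝ) + 1 - j) * T j + ∑ j ∈ Icc 1 X, T j := by
      rw [← sum_add_distrib]
      refine sum_congr rfl fun j _ => ?_
      push_cast; ring
    rw [this]
    push_cast
    ring

variable {F : Type*} [Field F] [Fintype F]

lemma totientRatio_le_of_dvd {f f' : F[X]} (hf : f ≠ 0) (hf' : f' ≠ 0)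
    (h : ∀ P : F[X], Irreducible P → P ∣ f → P ∣ f') : totientRatio f ≤ totientRatio f' := by
  refine prod_le_prod_of_subset_of_one_le ?_ ?_ ?_
  · intro P hP
    have := (mem_primeDivisors hf).1 hP
    exact (mem_primeDivisors hf').2 ⟨this.1, this.2.1, h P this.2.1 this.2.2⟩
  · intro P hP
    exact zero_le_one.trans (one_le_inv_one_sub ((mem_primeDivisors hf).1 hP).2.1)
  · intro P hP _
    exact one_le_inv_one_sub ((mem_primeDivisors hf').1 hP).2.1

lemma pow_sub_pow_ne_zero {K : Type*} [Field K] {g : K[X]} (hg : 1 ≤ g.natDegree) {k l : ℕ} (hkl : k ≠ l) :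
    g ^ k - g ^ l ≠ 0 := by
  intro h
  have h1 := congrArg natDegree (sub_eq_zero.1 h)
  rw [natDegree_pow, natDegree_pow] at h1
  exact hkl (Nat.eq_of_mul_eq_mul_right hg h1)

/-- Up to sign, the difference is a power of `g` times `g ^ |k - l| - 1`. The resulting bound
depends only on the distance of the exponents. -/
lemma totientRatio_pow_sub_pow_le {g : F[X]} (hg : 1 ≤ g.natDegree) {k l : ℕ} (hkl : k ≠ l) :
    totientRatio (g ^ k - g ^ l) ≤ totientRatio (g * (g ^ (k - l + (l - k)) - 1)) := by
  have hg0 : g ≠ 0 := by rintro rfl; simp at hg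
  refine totientRatio_le_of_dvd (pow_sub_pow_ne_zero hg hkl)
    (mul_ne_zero hg0 (pow_sub_one_ne_zero hg (by omega))) fun P hP hd => ?_
  rcases lt_or_gt_of_ne hkl with h | h
  · have h1 : g ^ k - g ^ l = g ^ k * -(g ^ (l - k) - 1) := by
      rw [mul_neg, mul_sub, ← pow_add, Nat.add_sub_cancel' h.le]; ring
    rw [h1] at hd
    rw [Nat.sub_eq_zero_of_le h.le, zero_add]
    rcases hP.prime.dvd_or_dvd hd with h2 | h2
    · exact (hP.prime.dvd_of_dvd_pow h2).mul_right _
    · exact ((dvd_neg).1 h2).mul_left _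
  · have h1 : g ^ k - g ^ l = g ^ l * (g ^ (k - l) - 1) := by
      rw [mul_sub, ← pow_add, Nat.add_sub_cancel' h.le]; ring
    rw [h1] at hd
    rw [Nat.sub_eq_zero_of_le h.le, add_zero]
    rcases hP.prime.dvd_or_dvd hd with h2 | h2
    · exact (hP.prime.dvd_of_dvd_pow h2).mul_right _
    · exact h2.mul_left _

lemma mem_romanoffSet_iff {n : ℕ} {g f : F[X]} (hn : 1 ≤ n) :
    f ∈ romanoffSet n g ↔ f.natDegree = n ∧ ∃ (h : F[X]) (k : ℕ),
      h ∈ irreduciblesOfDegree F n ∧ f = h + g ^ k := by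
  have hdeg : ∀ p : F[X], p.degree = (n : WithBot ℕ) ↔ p.natDegree = n := fun p =>
    degree_eq_iff_natDegree_eq_of_pos hn
  simp only [romanoffSet, Set.mem_ofPred_eq, hdeg, mem_irreduciblesOfDegree, and_assoc]

lemma finite_romanoffSet {n : ℕ} (hn : 1 ≤ n) (g : F[X]) : (romanoffSet n g).Finite := by
  refine (ltDegree F (n + 1)).finite_toSet.subset fun f hf => ?_
  have h1 := ((mem_romanoffSet_iff hn).1 hf).1
  rw [mem_coe, mem_ltDegree]
  refine degree_le_natDegree.trans_lt ?_
  rw [h1]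
  exact_mod_cast Nat.lt_succ_self _

/-- Since `g ^ k = f - h` has degree at most `n`, only `k ≤ n / g.natDegree` can occur. -/
lemma romanoffCount_le {n : ℕ} (hn : 1 ≤ n) {g : F[X]} (hg : 1 ≤ g.natDegree) :
    romanoffCount n g ≤ (irreduciblesOfDegree F n).card * (n / g.natDegree + 1) := by
  classical
  have hsub : romanoffSet n g ⊆ (((irreduciblesOfDegree F n) ×ˢ range (n / g.natDegree + 1)).image
      fun p => p.1 + g ^ p.2 : Finset F[X]) := by
    intro f hf
    obtain ⟨h1, h, k, hh, rfl⟩ := (mem_romanoffSet_iff hn).1 hf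
    rw [mem_coe, mem_image]
    refine ⟨(h, k), mem_product.2 ⟨hh, ?_⟩, rfl⟩
    rw [mem_range, Nat.lt_succ_iff, Nat.le_div_iff_mul_le hg, ← natDegree_pow]
    have h2 : g ^ k = (h + g ^ k) - h := by ring
    rw [h2]
    refine (natDegree_sub_le _ _).trans ?_
    rw [h1, (mem_irreduciblesOfDegree.1 hh).2, max_self]
  refine (Set.ncard_le_ncard hsub (Finset.finite_toSet _)).trans ?_
  rw [Set.ncard_coe_finset]
  refine card_image_le.trans ?_
  rw [card_product, card_range]

/-- The condition on `X` keeps every sum `h + g ^ k` in degree `n`. Equal exponents give the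
diagonal term, distinct ones the twin bound grouped by distance. -/
lemma sq_card_irreducibles_le {n X : ℕ} (hn : 1 ≤ n) {g : F[X]} (hg : 1 ≤ g.natDegree)
    (hX : X * g.natDegree < n) :
    (((irreduciblesOfDegree F n).card : ℝ) * (X + 1)) ^ 2 ≤ romanoffCount n g *
      ((irreduciblesOfDegree F n).card * (X + 1) +
        8 * (((Fintype.card F : ℝ) - 1) * (Fintype.card F : ℝ) ^ n) / (n : ℝ) ^ 2 *
          (2 * ∑ j ∈ Icc 1 X, ((X : ℝ) + 1 - j) * totientRatio (g * (g ^ j - 1)))) := by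
  classical
  set I := irreduciblesOfDegree F n with hI
  set c : ℝ := 8 * (((Fintype.card F : ℝ) - 1) * (Fintype.card F : ℝ) ^ n) / (n : ℝ) ^ 2 with hc
  have hn0 : (0 : ℝ) < n := by exact_mod_cast hn
  have hq := two_le_card (F := F)
  have hc0 : 0 ≤ c := div_nonneg (mul_nonneg (by norm_num) (mul_nonneg (by linarith) (by positivity)))
    (by positivity)
  have hmaps : ∀ p ∈ I ×ˢ range (X + 1), p.1 + g ^ p.2 ∈ (finite_romanoffSet hn g).toFinset := by
    intro p hp
    rw [mem_product, mem_range] at hp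
    rw [Set.Finite.mem_toFinset, mem_romanoffSet_iff hn]
    refine ⟨?_, p.1, p.2, hp.1, rfl⟩
    have h1 := (mem_irreduciblesOfDegree.1 hp.1).2
    rw [natDegree_add_eq_left_of_natDegree_lt, h1]
    rw [natDegree_pow, h1]
    exact lt_of_le_of_lt (Nat.mul_le_mul_right _ (by omega)) hX
  have hCS := sq_card_le_card_mul_collisions (I ×ˢ range (X + 1)) _ (fun p => p.1 + g ^ p.2) hmaps
  rw [card_product, card_range, ← Set.ncard_eq_toFinset_card _ (finite_romanoffSet hn g)] at hCS
  push_cast at hCS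
  refine hCS.trans (mul_le_mul_of_nonneg_left ?_ (Nat.cast_nonneg _))
  have hpair : ∀ k l : ℕ, ∑ h ∈ I, ∑ h' ∈ I, (if h + g ^ k = h' + g ^ l then (1 : ℝ) else 0)
      = ((I.filter fun h => h + (g ^ k - g ^ l) ∈ I).card : ℝ) := by
    intro k l
    rw [card_eq_sum_ones, Nat.cast_sum, sum_filter]
    refine sum_congr rfl fun h _ => ?_
    have h1 : ∀ h', (h + g ^ k = h' + g ^ l) ↔ (h + (g ^ k - g ^ l) = h') := fun h' => by
      rw [← add_sub_assoc, sub_eq_iff_eq_add]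
    simp only [h1, sum_ite_eq]
    push_cast
    rfl
  have hbound : ∀ k l : ℕ, ((I.filter fun h => h + (g ^ k - g ^ l) ∈ I).card : ℝ)
      ≤ (if k = l then (I.card : ℝ) else 0) +
        c * (if k = l then 0 else totientRatio (g * (g ^ (k - l + (l - k)) - 1))) := by
    intro k l
    split_ifs with hkl
    · rw [mul_zero, add_zero]
      exact_mod_cast card_filter_le _ _
    · rw [zero_add]
      have h1 := card_twins_le hn (pow_sub_pow_ne_zero hg hkl)
      have h2 := totientRatio_pow_sub_pow_le hg hkl
      have h3 : ((I.filter fun h => h + (g ^ k - g ^ l) ∈ I).card : ℝ)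
          ≤ c * totientRatio (g ^ k - g ^ l) := by
        rw [hc, div_mul_eq_mul_div, le_div_iff₀ (by positivity)]
        linarith
      exact h3.trans (mul_le_mul_of_nonneg_left h2 hc0)
  calc ∑ a ∈ I ×ˢ range (X + 1), ∑ b ∈ I ×ˢ range (X + 1),
        (if a.1 + g ^ a.2 = b.1 + g ^ b.2 then (1 : ℝ) else 0)
      = ∑ k ∈ range (X + 1), ∑ l ∈ range (X + 1),
          ((I.filter fun h => h + (g ^ k - g ^ l) ∈ I).card : ℝ) := by
        rw [sum_product_right]
        refine sum_congr rfl fun k _ => ?_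
        simp_rw [sum_product_right]
        rw [sum_comm]
        exact sum_congr rfl fun l _ => hpair k l
    _ ≤ ∑ k ∈ range (X + 1), ∑ l ∈ range (X + 1), ((if k = l then (I.card : ℝ) else 0) +
        c * (if k = l then 0 else totientRatio (g * (g ^ (k - l + (l - k)) - 1)))) :=
        sum_le_sum fun k _ => sum_le_sum fun l _ => hbound k l
    _ = _ := by
        simp_rw [sum_add_distrib, ← mul_sum]
        rw [sum_sum_range_distance (fun j => totientRatio (g * (g ^ j - 1)))]
        congr 1
        rw [sum_congr rfl fun k hk => by rw [sum_ite_eq, if_pos hk], sum_const, card_range,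
          nsmul_eq_mul]
        push_cast
        ring

end Collisions

/-! ### Assembling the bounds -/

section MainTheorem

open Real

variable {F : Type*} [Field F] [Fintype F]

lemma mul_card_irreducibles_le (n : ℕ) : (n : ℝ) * (irreduciblesOfDegree F n).card
    ≤ ((Fintype.card F : ℝ) - 1) * (Fintype.card F : ℝ) ^ n := by
  have hq := two_le_card (F := F)
  have h1 : (n : ℝ) * (primesOfDegree F n).card ≤ (Fintype.card F : ℝ) ^ n := by
    exact_mod_cast mul_card_primes_le n
  rw [card_irreduciblesOfDegree, mul_left_comm]
  exact mul_le_mul_of_nonneg_left h1 (by linarith)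

/-- The estimate will be squared, so a negative factor must be excluded or handled: it is negative
for `n = 1` and `q ≤ 3`. For `n = 1` the exact count `q` suffices; for `n ≥ 2` the factor is
nonnegative. -/
lemma abs_mul_le_mul_card_irreducibles {n : ℕ} (hn : 1 ≤ n) :
    |1 - 2 * (Fintype.card F : ℝ) ^ (-(n : ℝ) / 2)| *
        (((Fintype.card F : ℝ) - 1) * (Fintype.card F : ℝ) ^ n)
      ≤ n * (irreduciblesOfDegree F n).card ∧ 0 < (irreduciblesOfDegree F n).card := by
  have hq := two_le_card (F := F)
  set q : ℝ := (Fintype.card F : ℝ) with hqdef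
  have hqn : 0 < q ^ n := by positivity
  have hcard := card_irreduciblesOfDegree (F := F) n
  rw [← hqdef] at hcard
  have hkey : |1 - 2 * q ^ (-(n : ℝ) / 2)| * q ^ n ≤ n * (primesOfDegree F n).card ∧
      0 < ((primesOfDegree F n).card : ℝ) := by
    rcases hn.eq_or_lt with rfl | hn2
    · rw [card_primes_one, ← hqdef]
      refine ⟨?_, by linarith⟩
      have h1 : q ^ (-((1 : ℕ) : ℝ) / 2) ≤ 1 :=
        rpow_le_one_of_one_le_of_nonpos (by linarith) (by norm_num)
      have h2 : 0 < q ^ (-((1 : ℕ) : ℝ) / 2) := rpow_pos_of_pos (by linarith) _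
      have h3 : |1 - 2 * q ^ (-((1 : ℕ) : ℝ) / 2)| ≤ 1 := by
        rw [abs_le]; constructor <;> linarith
      rw [pow_one, Nat.cast_one, one_mul]
      nlinarith
    · have h1 := lt_mul_card_primes (F := F) (n := n) (by omega)
      rw [← hqdef] at h1
      have h2 : q ^ (-(n : ℝ) / 2) ≤ 1 / 2 := by
        have hn' : (2 : ℝ) ≤ n := by exact_mod_cast hn2
        calc q ^ (-(n : ℝ) / 2) ≤ q ^ (-1 : ℝ) :=
              rpow_le_rpow_of_exponent_le (by linarith) (by linarith)
          _ = 1 / q := by rw [rpow_neg_one, one_div]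
          _ ≤ 1 / 2 := one_div_le_one_div_of_le (by norm_num) hq
      have h3 : 0 ≤ 1 - 2 * q ^ (-(n : ℝ) / 2) := by linarith
      rw [abs_of_nonneg h3]
      refine ⟨by linarith, ?_⟩
      have h4 : 0 < (n : ℝ) * (primesOfDegree F n).card :=
        lt_of_le_of_lt (mul_nonneg hqn.le h3) h1
      exact pos_of_mul_pos_right h4 (Nat.cast_nonneg _)
  constructor
  · rw [hcard, mul_left_comm, mul_left_comm (n : ℝ)]
    exact mul_le_mul_of_nonneg_left hkey.1 (by linarith)
  · have : (0 : ℝ) < (irreduciblesOfDegree F n).card := by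
      rw [hcard]; exact mul_pos (by linarith) hkey.2
    exact_mod_cast this

lemma romanoffCount_pos {n : ℕ} (hn : 1 ≤ n) {g : F[X]} (hg : 1 ≤ g.natDegree) :
    0 < romanoffCount n g := by
  have h1 := sq_card_irreducibles_le (X := 0) hn hg (by omega)
  have h2 : (0 : ℝ) < (irreduciblesOfDegree F n).card := by
    exact_mod_cast (abs_mul_le_mul_card_irreducibles (F := F) hn).2
  by_contra! h
  rw [Nat.le_zero.1 h] at h1
  norm_num at h1
  simp [h1] at h2

/-- The lower bound without the factor `(1 + δ / n)⁻¹`. -/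
lemma sq_mul_le_romanoffCount_mul {n : ℕ} (hn : 1 ≤ n) {g : F[X]} (hg : 1 ≤ g.natDegree) {V : ℝ}
    (hV0 : 0 ≤ V)
    (hV : ∀ X, 1 ≤ X → abelMean (fun x => totientRatio (orderPoly g x)) X ≤ V) :
    (1 - 2 * (Fintype.card F : ℝ) ^ (-(n : ℝ) / 2)) ^ 2 *
        (((Fintype.card F : ℝ) - 1) * (Fintype.card F : ℝ) ^ n)
      ≤ romanoffCount n g * (g.natDegree + 8 * V) := by
  have hq := two_le_card (F := F)
  have hn0 : (0 : ℝ) < n := by exact_mod_cast hn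
  -- The largest `X` with `X * δ < n`, so also `n ≤ (X + 1) * δ`.
  set X := (n - 1) / g.natDegree with hXdef
  have hX1 : X * g.natDegree < n := by
    have : X * g.natDegree ≤ n - 1 := Nat.div_mul_le_self _ _
    omega
  have hX2 : n ≤ (X + 1) * g.natDegree := by
    have : n - 1 < (X + 1) * g.natDegree := by
      rw [← Nat.div_lt_iff_lt_mul hg]; exact Nat.lt_succ_self _
    omega
  have hX1' : (X : ℝ) * g.natDegree ≤ n := by exact_mod_cast hX1.le
  have hX2' : (n : ℝ) ≤ ((X : ℝ) + 1) * g.natDegree := by exact_mod_cast hX2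
  set δ : ℝ := (g.natDegree : ℝ) with hδ
  set Q : ℝ := ((Fintype.card F : ℝ) - 1) * (Fintype.card F : ℝ) ^ n with hQ
  have hQ0 : 0 < Q := mul_pos (by linarith) (by positivity)
  set N : ℝ := ((irreduciblesOfDegree F n).card : ℝ) with hN
  set R : ℝ := (romanoffCount n g : ℝ) with hR
  have hR0 : 0 ≤ R := Nat.cast_nonneg _
  set E : ℝ := 1 - 2 * (Fintype.card F : ℝ) ^ (-(n : ℝ) / 2) with hE
  have hNub : n * N ≤ Q := mul_card_irreducibles_le n
  have hNlb : |E| * Q ≤ n * N := (abs_mul_le_mul_card_irreducibles hn).1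
  have hmain := sq_card_irreducibles_le (X := X) hn hg hX1
  have hT : 2 * ∑ j ∈ Icc 1 X, ((X : ℝ) + 1 - j) * totientRatio (g * (g ^ j - 1))
      ≤ (X : ℝ) * (X + 1) * V := by
    rcases Nat.eq_zero_or_pos X with h0 | h0
    · rw [h0]; simp
    · have h1 := sum_totientRatio_le hg h0
      have h2 := hV X h0
      rw [abelMean] at h2
      have h3 := h1.trans (mul_le_mul_of_nonneg_left h2 (by positivity))
      linarith
  have h1 : (N * (X + 1)) ^ 2 ≤ R * (N * (X + 1) + 8 * Q / (n : ℝ) ^ 2 * ((X : ℝ) * (X + 1) * V)) :=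
    hmain.trans (mul_le_mul_of_nonneg_left (by gcongr) hR0)
  have hX0 : (0 : ℝ) < (X : ℝ) + 1 := by positivity
  have h2 : N ^ 2 * (X + 1) ≤ R * (N + 8 * Q / (n : ℝ) ^ 2 * (X * V)) := by
    have : (N ^ 2 * (X + 1)) * ((X : ℝ) + 1)
        ≤ (R * (N + 8 * Q / (n : ℝ) ^ 2 * (X * V))) * ((X : ℝ) + 1) := by
      calc (N ^ 2 * (X + 1)) * ((X : ℝ) + 1) = (N * (X + 1)) ^ 2 := by ring
        _ ≤ _ := h1
        _ = _ := by ring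
    exact le_of_mul_le_mul_right this hX0
  have h3 : (n * N) ^ 2 * (X + 1) ≤ R * (n * (n * N) + 8 * Q * (X * V)) := by
    calc (n * N) ^ 2 * (X + 1) = (n : ℝ) ^ 2 * (N ^ 2 * (X + 1)) := by ring
      _ ≤ (n : ℝ) ^ 2 * (R * (N + 8 * Q / (n : ℝ) ^ 2 * (X * V))) := by gcongr
      _ = _ := by field_simp
  have h4 : E ^ 2 * Q ^ 2 ≤ (n * N) ^ 2 := by
    calc E ^ 2 * Q ^ 2 = (|E| * Q) ^ 2 := by rw [mul_pow |E|, sq_abs]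
      _ ≤ _ := by gcongr
  have hδ0 : 0 ≤ δ := Nat.cast_nonneg _
  -- Multiplying by `δ` eliminates `X`: `(X + 1) * δ ≥ n` serves the left side and `X * δ ≤ n` the
  -- right.
  have h5 : E ^ 2 * Q * (n * Q) ≤ R * (δ + 8 * V) * (n * Q) := by
    calc E ^ 2 * Q * (n * Q) = E ^ 2 * Q ^ 2 * n := by ring
      _ ≤ (n * N) ^ 2 * (((X : ℝ) + 1) * δ) := by gcongr
      _ = ((n * N) ^ 2 * (X + 1)) * δ := by ring
      _ ≤ (R * (n * (n * N) + 8 * Q * (X * V))) * δ := by gcongr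
      _ = R * (n * (n * N) * δ + 8 * Q * V * (X * δ)) := by ring
      _ ≤ R * (n * Q * δ + 8 * Q * V * n) := by gcongr
      _ = _ := by ring
  exact le_of_mul_le_mul_right h5 (by positivity)

end MainTheorem

end PolynomialSieve

theorem theorem2 {F : Type*} [Field F] [Fintype F] (q : ℕ) (hq : Fintype.card F = q)
    (g : Polynomial F) (δ : ℕ) (hg : g.natDegree = δ) (hδ : 1 ≤ δ) (n : ℕ) (hn : 1 ≤ n) :
    (1 + (δ : ℝ) / n) / δ ≥ romanoffProportion n g ∧
    romanoffProportion n g >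
      ((1 - 2 * (q : ℝ) ^ (-(n : ℝ) / 2)) ^ 2 * (1 + (δ : ℝ) / n)⁻¹) /
        ((δ : ℝ) + 8 * ((q : ℝ) / ((q : ℝ) - 1)) *
          (1 + Real.exp Real.eulerMascheroniConstant *
            min (5 * Real.sqrt ((δ : ℝ) / q)) (Real.log (6 * (δ : ℝ)) / Real.log q))) := by
  subst hq hg
  have hq := PolynomialSieve.two_le_card (F := F)
  have hn0 : (0 : ℝ) < n := by exact_mod_cast hn
  have hδ0 : (0 : ℝ) < g.natDegree := by exact_mod_cast hδ
  have hQ0 : 0 < ((Fintype.card F : ℝ) - 1) * (Fintype.card F : ℝ) ^ n :=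
    mul_pos (by linarith) (by positivity)
  have hR : (0 : ℝ) < romanoffCount n g := by
    exact_mod_cast PolynomialSieve.romanoffCount_pos hn hδ
  rw [romanoffProportion]
  constructor
  · have h1 : (romanoffCount n g : ℝ) ≤ (PolynomialSieve.irreduciblesOfDegree F n).card *
        ((n : ℝ) / g.natDegree + 1) := by
      have h2 : (romanoffCount n g : ℝ) ≤ (PolynomialSieve.irreduciblesOfDegree F n).card *
          (((n / g.natDegree : ℕ) : ℝ) + 1) := by
        exact_mod_cast PolynomialSieve.romanoffCount_le hn hδ
      refine h2.trans ?_
      gcongr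
      exact Nat.cast_div_le
    have h3 := PolynomialSieve.mul_card_irreducibles_le (F := F) n
    rw [ge_iff_le, div_le_iff₀ hQ0]
    calc (romanoffCount n g : ℝ) ≤ (PolynomialSieve.irreduciblesOfDegree F n).card *
        ((n : ℝ) / g.natDegree + 1) := h1
      _ = (1 + (g.natDegree : ℝ) / n) / g.natDegree *
          (n * (PolynomialSieve.irreduciblesOfDegree F n).card) := by field_simp
      _ ≤ _ := by gcongr
  · set M := min (5 * Real.sqrt ((g.natDegree : ℝ) / Fintype.card F))
      (Real.log (6 * (g.natDegree : ℝ)) / Real.log (Fintype.card F)) with hM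
    have hM0 : 0 ≤ M := by
      have : (1 : ℝ) ≤ g.natDegree := by exact_mod_cast hδ
      exact le_min (by positivity)
        (div_nonneg (Real.log_nonneg (by linarith)) (Real.log_nonneg (by linarith)))
    set V := (Fintype.card F : ℝ) / ((Fintype.card F : ℝ) - 1) *
      (1 + Real.exp Real.eulerMascheroniConstant * M) with hV
    have hV0 : 0 ≤ V := mul_nonneg (div_nonneg (by linarith) (by linarith)) (by positivity)
    have h1 := PolynomialSieve.sq_mul_le_romanoffCount_mul hn hδ hV0
      fun X hX => PolynomialSieve.abelMean_totientRatio_le hδ hX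
    have hden : (g.natDegree : ℝ) + 8 * ((Fintype.card F : ℝ) / ((Fintype.card F : ℝ) - 1)) *
        (1 + Real.exp Real.eulerMascheroniConstant * M) = g.natDegree + 8 * V := by rw [hV]; ring
    rw [hden, gt_iff_lt, div_lt_div_iff₀ (by positivity) hQ0]
    set E := 1 - 2 * (Fintype.card F : ℝ) ^ (-(n : ℝ) / 2) with hE
    -- This factor is pure slack and supplies the strict inequality when `E ≠ 0`.
    have hinv : (1 + (g.natDegree : ℝ) / n)⁻¹ < 1 := inv_lt_one_of_one_lt₀ (by
      have : 0 < (g.natDegree : ℝ) / n := by positivity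
      linarith)
    -- `E` vanishes when `q ^ n = 4`; strictness then comes from positivity of the count.
    rcases eq_or_ne E 0 with h0 | h0
    · rw [h0]
      norm_num
      positivity
    · refine lt_of_lt_of_le ?_ h1
      refine mul_lt_mul_of_pos_right ?_ hQ0
      exact mul_lt_of_lt_one_right (by positivity) hinv
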